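/- Throughout $\log=\log_2$. Let $\Sigma$ be a $\Sigma$-protocol with finite commitment, challenge and response sets $\mathcal M,\mathcal C,\mathcal Z$, with (deterministic) verifier $\mathcal V$, for a relation $R$; assume it is special sound (from two accepting transcripts with the same commitment and different challenges an extractor $\mathsf{Ext}_{\rm ss}$ always produces a witness) and has unique responses (for every instance, commitment and challenge at most one response is accepted). Let $c>0$ be a constant and let $k,l\in\mathbb N$ satisfy $$2^{1/c}\le k\le 2^{2^l/(256c)},\qquad l\ge 14,\qquad N:=|\mathcal C|=c\cdot 2^l\cdot\log k .$$ *Setting.* A Fischlin proof is $\pi=(\mathbf a,\mathbf c,\mathbf z)\in\mathcal M^k\times\mathcal C^k\times\mathcal Z^k$. Fix an instance $x$ and a commitment vector $\mathbf a_0\in\mathcal M^k$; $\pi$ is accepted iff $\mathbf a=\mathbf a_0$ and, for all $i\in[k]$, $H(\mathbf a,i,c_i,z_i)=0^l$ and $\mathcal V(x,a_i,c_i,z_i)=1$, where $H:\mathcal M^k\times[k]\times\mathcal C\times\mathcal Z\to\{0,1\}^l$ is a random oracle. A dishonest prover $\mathcal P$ is an arbitrary quantum algorithm making any finite number of quantum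 queries to $H$, which is simulated by the compressed oracle, whose database $D$ has one register $D_y$ with basis $\{0,1\}^l\cup\{\bot\}$ for each input $y$. Let $\mathrm{Comp}$ be the compression unitary, which on each register swaps $|\bot\rangle$ with the uniform superposition $|{+^l}\rangle$ of the $l$-bit strings and is the identity on the orthogonal complement of these two vectors. Let $|\phi\rangle$ be the joint final state of prover and oracle in the uncompressed picture (that is, $\mathrm{Comp}$ applied to the final state of the run with the compressed oracle), before the output register is measured. Let $P_s$ be the projector onto the basis states in which the output register holds an accepted proof (with the hash values read off $D$ in the uncompressed picture). The extractor, after successful verification, measures $D$ in the compressed picture, takes the lexicographically first pair of recorded (non-$\bot$) inputs $(\mathbf a,i,c,z),(\mathbf a,i,c',z')$ with $(c,z)\neq(c',z')$ and $\mathcal V(x,a_i,c,z)=\mathcal V(x,a_i,c',z')=1$, and outputs $\mathsf{Ext}_{\rm ss}(x,a_i,c,z,c',z')$; it aborts if there is no such pair. It searches among the inputs with $\mathbf a\in S$, where $S\subseteq\mathcal M^k$ is a set containing $\mathbf a_0$; $S=\{\mathbf a_0\}$ is the extractor of the modified scheme with fixed commitments, and $S=\mathcal M^k$ is the unrestricted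 extractor. Let $\mathcal E_f$ be the projector onto the databases such that for every $i\in[k]$ at most one register $D_{(\mathbf a_0,i,c,z)}$ with $\mathcal V(x,(\mathbf a_0)_i,c,z)=1$ is not in state $|\bot\rangle$, and put $\tilde{\mathcal E}_f=\mathrm{Comp}\,\mathcal E_f\,\mathrm{Comp}$. *Claim.* There is a function $\varepsilon=\varepsilon(c,k,l)\in[0,1)$ of the parameters alone, with $$\varepsilon\le 3\exp\Big(-\frac{k}{128\cdot c\cdot 2^l\cdot\log k}\Big)+6\exp\Big(-\frac{k}{8\cdot 2^l}\Big),$$ such that for all $\Sigma$, $R$, $x$, $\mathbf a_0$ and $\mathcal P$ as above, the extractor for $S=\{\mathbf a_0\}$ satisfies $$\Pr[\text{prover succeeds and extractor does not output a witness}]=\big\|\tilde{\mathcal E}_fP_s|\phi\rangle\big\|^2\le\frac{\varepsilon}{1-\varepsilon},$$ and the same probability for every $S\ni\mathbf a_0$ is also at most $\varepsilon/(1-\varepsilon)$. Moreover the bound is negligible in $k$: for every constant $c>0$ and every choice $l=l(k)=O(\log\log k)$ that satisfies the constraints on $(c,k,l)$ for all large $k$, $\varepsilon/(1-\varepsilon)$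 tends to $0$ faster than every inverse polynomial in $k$; and for every $c>0$ such a choice exists, even with $l=\Theta(\log\log k)$. -/

import Mathlib

open Filter Asymptotics
open scoped Kronecker

noncomputable section

namespace Fischlin

universe u₁ u₂ u₃ u₄ u₅ u₆ u₇

/-! ### Sigma protocols -/

/-- A `Σ`-protocol for the relation `R` with instances `X`, witnesses `W`, commitments `M`,
challenges `C`, responses `Z` and prover state `St`: honest prover, (deterministic) verifier,
completeness and special soundness.  `ext` is the special-soundness extractor. -/
structure SigmaProtocol {X : Type u₁} {W : Type u₂} (R : X → W → Prop)
    (M : Type u₃) (C : Type u₄) (Z : Type u₅) (St : Type u₆) where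
  commit : X → W → PMF (M × St)
  respond : St → C → PMF Z
  verify : X → M → C → Z → Bool
  completeness : ∀ x w, R x w → ∀ p ∈ (commit x w).support, ∀ c, ∀ z ∈ (respond p.2 c).support,
    verify x p.1 c z = true
  ext : X → M → C → Z → C → Z → PMF W
  specialSoundness : ∀ x a c z c' z', c ≠ c' → verify x a c z = true → verify x a c' z' = true →
    ∀ w ∈ (ext x a c z c' z').support, R x w

/-- Unique responses: for every instance, commitment and challenge at most one response
is accepted. -/
def SigmaProtocol.UniqueResponses {X : Type u₁} {W : Type u₂} {R : X → W → Prop}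
    {M : Type u₃} {C : Type u₄} {Z : Type u₅} {St : Type u₆}
    (P : SigmaProtocol R M C Z St) : Prop :=
  ∀ x a c z z', z ≠ z' → P.verify x a c z = false ∨ P.verify x a c z' = false

/-! ### Registers -/

/-- Hash values `{0,1}^l`; addition is bitwise xor and `0` is the string `0^l`. -/
abbrev Hash (l : ℕ) : Type := Fin l → ZMod 2

/-- Random oracle inputs `(𝐚, i, c, z)`. -/
abbrev OracleInput (k : ℕ) (M : Type u₃) (C : Type u₄) (Z : Type u₅) : Type (max u₃ u₄ u₅) :=
  (Fin k → M) × Fin k × C × Z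

/-- Fischlin proofs `(𝐚, 𝐜, 𝐳)`. -/
abbrev FProof (k : ℕ) (M : Type u₃) (C : Type u₄) (Z : Type u₅) : Type (max u₃ u₄ u₅) :=
  (Fin k → M) × (Fin k → C) × (Fin k → Z)

/-- Computational basis of the oracle register `D`; `none` is the symbol `⊥`. -/
abbrev Database (k l : ℕ) (M : Type u₃) (C : Type u₄) (Z : Type u₅) : Type (max u₃ u₄ u₅) :=
  OracleInput k M C Z → Option (Hash l)

/-- Computational basis of the prover's registers: query input, query output,
workspace `E`, and output register holding a proof. -/
abbrev Reg (k l : ℕ) (M : Type u₃) (C : Type u₄) (Z : Type u₅) (E : Type u₇) :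
    Type (max u₃ u₄ u₅ u₇) :=
  OracleInput k M C Z × Hash l × E × FProof k M C Z

/-- Computational basis of the joint system of prover and oracle. -/
abbrev Joint (k l : ℕ) (M : Type u₃) (C : Type u₄) (Z : Type u₅) (E : Type u₇) :
    Type (max u₃ u₄ u₅ u₇) :=
  Reg k l M C Z E × Database k l M C Z

section Instances

variable (k l : ℕ) (M : Type u₃) (C : Type u₄) (Z : Type u₅) (E : Type u₇)
  [DecidableEq M] [DecidableEq C] [DecidableEq Z] [DecidableEq E]

instance instDecidableEqOracleInput : DecidableEq (OracleInput k M C Z) := instDecidableEqProd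

instance instDecidableEqFProof : DecidableEq (FProof k M C Z) := instDecidableEqProd

instance instDecidableEqReg : DecidableEq (Reg k l M C Z E) := instDecidableEqProd

instance instDecidableEqJoint [Fintype M] [Fintype C] [Fintype Z] :
    DecidableEq (Joint k l M C Z E) := instDecidableEqProd

end Instances

/-- The projector onto the span of the basis vectors indexed by `S`. -/
def proj {ι : Type*} [DecidableEq ι] (S : Set ι) : Matrix ι ι ℂ :=
  Matrix.diagonal (S.indicator 1)

/-! ### The compressed oracle -/

/-- The vector `|+^l⟩`, inside `ℂ^(Hash l ∪ {⊥})`. -/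
def plusVec (l : ℕ) : Option (Hash l) → ℂ
  | none => 0
  | some _ => ((1 / Real.sqrt (2 ^ l) : ℝ) : ℂ)

/-- The vector `|⊥⟩`. -/
def botVec (l : ℕ) : Option (Hash l) → ℂ := Pi.single none 1

/-- The single-register compression unitary
`|⊥⟩⟨+| + |+⟩⟨⊥| + (1 - |+⟩⟨+| - |⊥⟩⟨⊥|)`. -/
def comp (l : ℕ) : Matrix (Option (Hash l)) (Option (Hash l)) ℂ :=
  Matrix.vecMulVec (botVec l) (star (plusVec l)) + Matrix.vecMulVec (plusVec l) (star (botVec l))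
    + (1 - Matrix.vecMulVec (plusVec l) (star (plusVec l))
        - Matrix.vecMulVec (botVec l) (star (botVec l)))

section Oracle

variable (k l : ℕ) (M : Type u₃) (C : Type u₄) (Z : Type u₅) (E : Type u₇)
  [Fintype M] [LinearOrder M] [Fintype C] [LinearOrder C] [Fintype Z] [LinearOrder Z]
  [Fintype E] [DecidableEq E]

/-- `Comp` applied to all registers `D_x`. -/
def compDB : Matrix (Database k l M C Z) (Database k l M C Z) ℂ :=
  Matrix.of fun D D' => ∏ x, comp l (D x) (D' x)

/-- `Comp` applied to the register `D_x` only. -/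
def compAt (x : OracleInput k M C Z) : Matrix (Database k l M C Z) (Database k l M C Z) ℂ :=
  Matrix.of fun D D' => if ∀ x', x' ≠ x → D x' = D' x' then comp l (D x) (D' x) else 0

/-- `CNOT` from `D_x` to the query output register:
`|y⟩|D⟩ ↦ |y ⊕ D(x)⟩|D⟩`, and the identity if `D(x) = ⊥`. -/
def cnotAt (x : OracleInput k M C Z) :
    Matrix (Hash l × Database k l M C Z) (Hash l × Database k l M C Z) ℂ :=
  Matrix.of fun s s' => if s.2 = s'.2 ∧ s.1 = s'.1 + (s'.2 x).getD 0 then 1 else 0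

/-- `O^x = Comp_{D_x} CNOT Comp_{D_x}` on query output and database. -/
def oracleAt (x : OracleInput k M C Z) :
    Matrix (Hash l × Database k l M C Z) (Hash l × Database k l M C Z) ℂ :=
  ((1 : Matrix (Hash l) (Hash l) ℂ) ⊗ₖ compAt k l M C Z x) * cnotAt k l M C Z x *
    ((1 : Matrix (Hash l) (Hash l) ℂ) ⊗ₖ compAt k l M C Z x)

/-- The compressed oracle query unitary `∑_x |x⟩⟨x| ⊗ O^x`, extended by the identity on
the workspace and the output register. -/
def oracle : Matrix (Joint k l M C Z E) (Joint k l M C Z E) ℂ :=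
  Matrix.of fun s s' =>
    if s.1.1 = s'.1.1 ∧ s.1.2.2 = s'.1.2.2 then
      oracleAt k l M C Z s.1.1 (s.1.2.1, s.2) (s'.1.2.1, s'.2)
    else 0

/-- `Comp_D` on the joint system. -/
def compJoint : Matrix (Joint k l M C Z E) (Joint k l M C Z E) ℂ :=
  (1 : Matrix (Reg k l M C Z E) (Reg k l M C Z E) ℂ) ⊗ₖ compDB k l M C Z

end Oracle

/-! ### Provers -/

/-- A dishonest prover: a quantum query algorithm with unit initial state, making `queries`
queries and applying the unitary `unitary i` after query number `i` (counting from `0`).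
Its output register is measured at the end. -/
structure Prover (k l : ℕ) (M : Type u₃) (C : Type u₄) (Z : Type u₅) (E : Type u₇)
    [Fintype M] [LinearOrder M] [Fintype C] [LinearOrder C] [Fintype Z] [LinearOrder Z]
    [Fintype E] [DecidableEq E] where
  queries : ℕ
  init : EuclideanSpace ℂ (Reg k l M C Z E)
  norm_init : ‖init‖ = 1
  unitary : ℕ → Matrix.unitaryGroup (Reg k l M C Z E) ℂ

section Game

variable {k l : ℕ} {M : Type u₃} {C : Type u₄} {Z : Type u₅} {E : Type u₇}
  [Fintype M] [LinearOrder M] [Fintype C] [LinearOrder C] [Fintype Z] [LinearOrder Z]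
  [Fintype E] [DecidableEq E]

/-- Joint state (compressed picture) of prover and compressed oracle after `n` rounds, each
consisting of a query and the prover's unitary, starting from `|φ₀⟩ ⊗ |⊥ ⋯ ⊥⟩`. -/
def Prover.stateAfter (A : Prover k l M C Z E) : ℕ → EuclideanSpace ℂ (Joint k l M C Z E)
  | 0 => WithLp.toLp 2 fun s => if s.2 = (fun _ => none) then A.init s.1 else 0
  | n + 1 =>
    Matrix.toEuclideanLin
      ((A.unitary n : Matrix (Reg k l M C Z E) (Reg k l M C Z E) ℂ) ⊗ₖ
        (1 : Matrix (Database k l M C Z) (Database k l M C Z) ℂ))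
      (Matrix.toEuclideanLin (oracle k l M C Z E) (A.stateAfter n))

/-- The final joint state `|φ⟩` in the uncompressed picture, before the output register
is measured. -/
def Prover.finalState (A : Prover k l M C Z E) : EuclideanSpace ℂ (Joint k l M C Z E) :=
  Matrix.toEuclideanLin (compJoint k l M C Z E) (A.stateAfter A.queries)

variable {X : Type u₁} {W : Type u₂} {R : X → W → Prop} {St : Type u₆}

/-- The Fischlin verifier with fixed commitment vector `a₀`, run on the function table `H`:
the proof starts with `a₀`, its `k` hash values are `0^l`, and its `k` transcripts
are accepted by the `Σ`-protocol verifier. -/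
def Accepts (P : SigmaProtocol R M C Z St) (x : X) (a₀ : Fin k → M) (H : Database k l M C Z)
    (π : FProof k M C Z) : Prop :=
  π.1 = a₀ ∧ ∀ i, H (π.1, i, π.2.1 i, π.2.2 i) = some 0 ∧
    P.verify x (π.1 i) (π.2.1 i) (π.2.2 i) = true

/-- The success projector `P_s`. -/
def successProj (P : SigmaProtocol R M C Z St) (x : X) (a₀ : Fin k → M) :
    Matrix (Joint k l M C Z E) (Joint k l M C Z E) ℂ :=
  proj {s | Accepts P x a₀ s.2 s.1.2.2.2}

/-- The projector `𝓔_f` (compressed picture): for every `i` at most one of the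
registers `D_{(a₀,i,c,z)}` with `(a₀ i, c, z)` accepted by the `Σ`-protocol verifier is
not in state `|⊥⟩`. -/
def failProj (P : SigmaProtocol R M C Z St) (x : X) (a₀ : Fin k → M) :
    Matrix (Joint k l M C Z E) (Joint k l M C Z E) ℂ :=
  proj {s | ∀ i, {cz : C × Z | P.verify x (a₀ i) cz.1 cz.2 = true ∧
    s.2 (a₀, i, cz.1, cz.2) ≠ none}.Subsingleton}

/-- `𝓔_f` in the uncompressed picture, `Comp_D 𝓔_f Comp_D`. -/
def failProjComp (P : SigmaProtocol R M C Z St) (x : X) (a₀ : Fin k → M) :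
    Matrix (Joint k l M C Z E) (Joint k l M C Z E) ℂ :=
  compJoint k l M C Z E * failProj P x a₀ * compJoint k l M C Z E

/-! ### The extractor -/

/-- The pairs of inputs `((𝐚,i,c,z),(𝐚,i,c',z'))` recorded in the measured database `D` with
`𝐚 ∈ S`, `(c,z) ≠ (c',z')`, and both transcripts accepted. -/
def goodPairs (P : SigmaProtocol R M C Z St) (x : X) (S : Set (Fin k → M))
    (D : Database k l M C Z) : Set (OracleInput k M C Z × OracleInput k M C Z) :=
  {p | ∃ (a : Fin k → M) (i : Fin k) (c c' : C) (z z' : Z),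
    p = ((a, i, c, z), (a, i, c', z')) ∧ a ∈ S ∧ D (a, i, c, z) ≠ none ∧ D (a, i, c', z') ≠ none ∧
    (c, z) ≠ (c', z') ∧ P.verify x (a i) c z = true ∧ P.verify x (a i) c' z' = true}

/-- An oracle input, viewed in the lexicographically ordered product. -/
def lexKey (p : OracleInput k M C Z) : (Lex (Fin k → M)) ×ₗ (Fin k ×ₗ (C ×ₗ Z)) :=
  toLex (toLex p.1, toLex (p.2.1, toLex (p.2.2.1, p.2.2.2)))

open Classical in
/-- The lexicographically first pair in `goodPairs`, if there is one. -/
def firstPair (P : SigmaProtocol R M C Z St) (x : X) (S : Set (Fin k → M))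
    (D : Database k l M C Z) : Option (OracleInput k M C Z × OracleInput k M C Z) :=
  if h : (goodPairs P x S D).Nonempty then
    some (Set.exists_min_image (goodPairs P x S D) (fun p => toLex (lexKey p.1, lexKey p.2))
      (Set.toFinite _) h).choose
  else none

/-- The output of the Fischlin extractor, searching for transcripts with commitment vector
in `S`, on a measured database; `none` means abort. -/
def extractor (P : SigmaProtocol R M C Z St) (x : X) (S : Set (Fin k → M))
    (D : Database k l M C Z) : PMF (Option W) :=
  match firstPair P x S D with
  | none => PMF.pure none
  | some ((a, i, c, z), (_, _, c', z')) => (P.ext x (a i) c z c' z').map some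

/-- The probability that the output of the extractor on database `D` is not a witness. -/
def extractFailProb (P : SigmaProtocol R M C Z St) (x : X) (S : Set (Fin k → M))
    (D : Database k l M C Z) : ℝ :=
  ((extractor P x S D).toOuterMeasure {o | ∀ w, o = some w → ¬ R x w}).toReal

/-- The probability that the proof output by the prover `A` is accepted (with commitment vector
`a₀`), and the extractor, measuring the compressed database after the successful
verification, does not output a witness. -/
def winProb (P : SigmaProtocol R M C Z St) (x : X) (a₀ : Fin k → M) (S : Set (Fin k → M))
    (A : Prover k l M C Z E) : ℝ :=
  ∑ s, ‖(Matrix.toEuclideanLin (compJoint k l M C Z E)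
      (Matrix.toEuclideanLin (successProj P x a₀) A.finalState)) s‖ ^ 2 *
    extractFailProb P x S s.2

end Game

/-! ### Parameters -/

/-- The constraints on the parameters `c`, `k`, `l`. -/
def Admissible (c : ℝ) (k l : ℕ) : Prop :=
  0 < c ∧ (2 : ℝ) ^ (1 / c) ≤ (k : ℝ) ∧ (k : ℝ) ≤ (2 : ℝ) ^ ((2 : ℝ) ^ l / (256 * c)) ∧ 14 ≤ l

/-- The upper bound on `ε`. -/
def epsBound (c : ℝ) (k l : ℕ) : ℝ :=
  3 * Real.exp (-((k : ℝ) / (128 * c * 2 ^ l * Real.logb 2 k))) +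
    6 * Real.exp (-((k : ℝ) / (8 * 2 ^ l)))

end Fischlin

end

/-!
A bound on the probability that a quantum prover succeeds against the Fischlin verifier while the
straight-line extractor fails.

*The oracle is uniform.* Conjugation by `Comp` turns the compressed query operator into the plain
one, `|x, y⟩|D⟩ ↦ |x, y + D x⟩|D⟩` (`compJoint_oracle_mulVec_apply`). This preserves the mass on
each database, and so do the prover's unitaries. Hence the mass of the final uncompressed state on
a function `f` is the same for every `f`, however many queries were made, and there is no mass on
databases with an entry `⊥` (`mass_stateAfter`). This is the only fact about the prover that the
argument uses.

*Failure forces an unusual function.* For a repetition `i` let `J i` be the set of inputs with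
commitment `a₀` and an accepted transcript; as responses are unique, it has at most `N` elements. A
basis state in the range of `𝓔_f` records at most one input of `J i`, and an unrecorded register
decompresses to the uniform superposition. So a decompressed vector in the range of `𝓔_f` is, as a
function of the values of `f` on `J i`, of degree at most one: a constant plus a sum of functions of
single values (`exists_deg_one_sum`). On the success event one value in each `J i` is zero. For a
function of degree one this adds nearly one full zero to the `card (J i) / 2 ^ l` zeros expected of
a uniform `f` (`block_bound`). The bounds for the `k` disjoint blocks multiply
(`sum_prod_blocks_le`), so such a vector has a fraction of at most `exp (-s k / 4)` of its mass on
the successful `f` whose number of zeros is at most the threshold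
`∑ i, (card (J i) / 2 ^ l + 1 / 2)` (`sum_few_hits_le`). By duality, `𝓔_f` reduces the mass of the
part of the state below the threshold by the same factor (`sum_norm_sq_oneRecorded_le`).

*Unusual functions are rare.* By a Chernoff bound, a uniform `f` exceeds the threshold with
probability at most `exp (-s k / 4)` (`card_many_hits_le`), and by uniformity the same holds for the
part of the state above the threshold.

With `s = 1 / (8 c log k)` the two parts give `4 exp (-k / (32 c log k))`. This is below
the required bound whenever the latter is not trivial, so `ε` may be taken to be the required bound
cut off at `1 / 2`. Special soundness and unique responses identify failure of the extractor for
`S = {a₀}` with `𝓔_f` (`winProb_singleton`), and a larger `S` only enlarges the set of pairs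
available to the extractor.
-/

noncomputable section

namespace Fischlin

universe u₁ u₂ u₃ u₄ u₅ u₆ u₇

/-! ### Functions of degree one under a tilted product measure -/

/-- Under a product of probability weights the coordinates are independent. -/
theorem sum_prod_weights {J H : Type*} [Fintype J] [DecidableEq J] [Fintype H] [DecidableEq H]
    {W : J → H → ℝ} (hW : ∀ j, ∑ h, W j h = 1) (S : Finset J) (u : J → H → ℝ) :
    ∑ g : J → H, (∏ j, W j (g j)) * ∏ j ∈ S, u j (g j) = ∏ j ∈ S, ∑ h, W j h * u j h := by
  have h1 : ∀ g : J → H, (∏ j, W j (g j)) * ∏ j ∈ S, u j (g j) =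
      ∏ j, (W j (g j) * if j ∈ S then u j (g j) else 1) := by
    intro g
    rw [Finset.prod_mul_distrib]
    simp
  simp_rw [h1]
  have h2 := Finset.prod_univ_sum (fun _ : J => (Finset.univ : Finset H))
    (fun j h => W j h * if j ∈ S then u j h else 1)
  rw [Fintype.piFinset_univ] at h2
  rw [← h2, ← Finset.prod_subset (Finset.subset_univ S)]
  · refine Finset.prod_congr rfl fun j hj => ?_
    simp [hj]
  · intro j _ hj
    simp [hj, hW]

/-- Second moment of a sum of centered functions of independent coordinates. -/
theorem sum_prod_weights_sq {J H : Type*} [Fintype J] [DecidableEq J] [Fintype H]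
    [DecidableEq H] {W : J → H → ℝ} (hW : ∀ j, ∑ h, W j h = 1) (a : ℝ) {b : J → H → ℝ}
    (hb : ∀ j, ∑ h, W j h * b j h = 0) :
    ∑ g : J → H, (∏ j, W j (g j)) * (a + ∑ j, b j (g j)) ^ 2 =
      a ^ 2 + ∑ j, ∑ h, W j h * b j h ^ 2 := by
  have h0 : ∑ g : J → H, (∏ j, W j (g j)) = 1 := by
    simpa using sum_prod_weights hW ∅ b
  have h1 : ∀ j, ∑ g : J → H, (∏ j, W j (g j)) * b j (g j) = 0 := by
    intro j
    simpa [hb] using sum_prod_weights hW {j} b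
  have h2 : ∀ j, ∑ g : J → H, (∏ j, W j (g j)) * b j (g j) ^ 2 = ∑ h, W j h * b j h ^ 2 := by
    intro j
    simpa using sum_prod_weights hW {j} (fun j h => b j h ^ 2)
  have h3 : ∀ i j, i ≠ j → ∑ g : J → H, (∏ j, W j (g j)) * (b i (g i) * b j (g j)) = 0 := by
    intro i j hij
    have := sum_prod_weights hW {i, j} b
    simpa [hb, Finset.prod_pair hij] using this
  have h4 : ∀ g : J → H, (∏ j, W j (g j)) * (a + ∑ j, b j (g j)) ^ 2 =
      a ^ 2 * (∏ j, W j (g j)) + 2 * a * (∑ j, (∏ j, W j (g j)) * b j (g j)) +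
        ∑ i, ∑ j, (∏ j, W j (g j)) * (b i (g i) * b j (g j)) := by
    intro g
    have : ∑ i, ∑ j, (∏ j, W j (g j)) * (b i (g i) * b j (g j)) =
        (∏ j, W j (g j)) * (∑ j, b j (g j)) ^ 2 := by
      rw [sq, Finset.sum_mul_sum]
      simp_rw [Finset.mul_sum]
    rw [this, ← Finset.mul_sum]
    ring
  simp_rw [h4, Finset.sum_add_distrib]
  rw [← Finset.mul_sum, ← Finset.mul_sum, h0, Finset.sum_comm,
    Finset.sum_comm (s := Finset.univ (α := J → H))]
  simp_rw [h1]
  have h5 : ∀ i, ∑ g : J → H, ∑ j, (∏ j, W j (g j)) * (b i (g i) * b j (g j)) =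
      ∑ h, W i h * b i h ^ 2 := by
    intro i
    rw [Finset.sum_comm, Finset.sum_eq_single i]
    · simp_rw [← h2, sq]
    · intro j _ hj
      exact h3 i j hj.symm
    · simp
  simp_rw [h5]
  simp

/-- The constant of `block_bound`. Here `K` is the number of hash values and `n = m + 1` the size of
the block; `K - (1 - exp (-s))` is the total mass of the tilted weights on one coordinate. -/
theorem block_factor_le {s K n : ℝ} (hs : 0 < s) (hs1 : s ≤ 1 / 8) (hK : 2 ^ 14 ≤ K)
    (hn : s * n ≤ K / 8) (m : ℕ) (hm : (m : ℝ) + 1 = n) :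
    Real.exp (-s) * (K - (1 - Real.exp (-s))) ^ m * (1 + s / 16) ≤
      Real.exp (-s * (n / K + 3 / 4)) * K ^ m := by
  have hK0 : 0 < K := by linarith [show (0:ℝ) < 2 ^ 14 by norm_num]
  set d := 1 - Real.exp (-s) with hd
  have hd1 : d ≤ s := by have := Real.add_one_le_exp (-s); linarith
  have hd0 : 0 ≤ d := by
    have : Real.exp (-s) ≤ 1 := Real.exp_le_one_iff.2 (by linarith)
    linarith
  have hd2 : s - s ^ 2 / 2 ≤ d := by
    have h1 := Real.quadratic_le_exp_of_nonneg hs.le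
    have h2 : Real.exp (-s) * Real.exp s = 1 := by rw [← Real.exp_add]; simp
    have h3 := Real.exp_pos (-s)
    have h4 : Real.exp (-s) ≤ 1 - s + s ^ 2 / 2 := by
      have h5 : 1 ≤ (1 - s + s ^ 2 / 2) * (1 + s + s ^ 2 / 2) := by nlinarith [sq_nonneg (s^2)]
      have h6 : 0 < 1 - s + s ^ 2 / 2 := by nlinarith
      have h7 : 1 ≤ (1 - s + s ^ 2 / 2) * Real.exp s := h5.trans (by gcongr)
      calc Real.exp (-s) = Real.exp (-s) * 1 := by ring
        _ ≤ Real.exp (-s) * ((1 - s + s ^ 2 / 2) * Real.exp s) := by gcongr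
        _ = (1 - s + s ^ 2 / 2) * (Real.exp (-s) * Real.exp s) := by ring
        _ = _ := by rw [h2, mul_one]
    linarith
  have h1 : K - d ≤ K * Real.exp (-(d / K)) := by
    have := Real.add_one_le_exp (-(d / K))
    calc K - d = K * (-(d / K) + 1) := by field_simp; ring
      _ ≤ _ := by gcongr
  have h2 : (0 : ℝ) ≤ K - d := by
    have : (1 : ℝ) / 8 ≤ 2 ^ 14 := by norm_num
    linarith
  have h3 : 1 + s / 16 ≤ Real.exp (s / 16) := by
    have := Real.add_one_le_exp (s / 16); linarith
  have hm0 : (0 : ℝ) ≤ m := m.cast_nonneg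
  calc Real.exp (-s) * (K - d) ^ m * (1 + s / 16)
      ≤ Real.exp (-s) * (K * Real.exp (-(d / K))) ^ m * Real.exp (s / 16) := by gcongr
    _ = Real.exp (-s + m * (-(d / K)) + s / 16) * K ^ m := by
        rw [mul_pow, ← Real.exp_nat_mul, Real.exp_add, Real.exp_add]; ring
    _ ≤ _ := by
        gcongr
        have h4 : m * d / K ≥ (n * (s - s ^ 2 / 2) - d) / K := by
          gcongr
          nlinarith
        have h5 : s * n / K ≤ 1 / 8 := by
          rw [div_le_iff₀ hK0]; linarith
        have h6 : d / K ≤ s / 16 := by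
          rw [div_le_iff₀ hK0]
          have : (1:ℝ) * 16 ≤ 2 ^ 14 := by norm_num
          nlinarith
        have h7 : (n * (s - s ^ 2 / 2) - d) / K = s * n / K - s * n / K * (s / 2) - d / K := by
          field_simp
        have h8 : s * n / K * (s / 2) ≤ 1 / 8 * (s / 2) := by gcongr
        have h9 : m * (-(d / K)) = - (m * d / K) := by ring
        have h10 : -s * (n / K + 3 / 4) = - (s * n / K) - 3 / 4 * s := by ring
        rw [h9, h10]
        linarith

/-- Second moment of a sum of functions of independent coordinates: the square of the mean plus the
sum of the variances. -/
theorem sum_prod_weights_sq_of_mean {J H : Type*} [Fintype J] [DecidableEq J] [Fintype H]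
    [DecidableEq H] {W : J → H → ℝ} (hW : ∀ j, ∑ h, W j h = 1) (a : ℝ) (b : J → H → ℝ)
    (m : J → ℝ) (hm : ∀ j, ∑ h, W j h * b j h = m j) :
    ∑ g : J → H, (∏ j, W j (g j)) * (a + ∑ j, b j (g j)) ^ 2 =
      (a + ∑ j, m j) ^ 2 + ∑ j, (∑ h, W j h * b j h ^ 2 - m j ^ 2) := by
  have h1 := sum_prod_weights_sq hW (a + ∑ j, m j) (b := fun j h => b j h - m j) (by
    intro j
    simp_rw [mul_sub, Finset.sum_sub_distrib, ← Finset.sum_mul, hm, hW]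
    ring)
  have h2 : ∀ g : J → H, a + ∑ j, m j + ∑ j, (b j (g j) - m j) = a + ∑ j, b j (g j) := by
    intro g
    rw [Finset.sum_sub_distrib]
    ring
  simp_rw [h2] at h1
  rw [h1]
  congr 1
  refine Finset.sum_congr rfl fun j _ => ?_
  have h3 : ∀ h, W j h * (b j h - m j) ^ 2 =
      W j h * b j h ^ 2 - 2 * m j * (W j h * b j h) + m j ^ 2 * W j h := by intro h; ring
  simp_rw [h3, Finset.sum_add_distrib, Finset.sum_sub_distrib, ← Finset.mul_sum, hm, hW]
  ring

/-- `block_bound` for real functions in orthogonal form. The weights on the left define, up to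
normalization, a product measure: a point mass at coordinate `j0`, and at the others the uniform
measure tilted by `exp (-s)` at `h0`. The tilted and the uniform second moment are compared by
means of `sum_prod_weights_sq_of_mean`; the tilted means of the centered functions `b j` are so
small that they contribute a factor of only `1 + s / 16`. -/
theorem block_bound_of_centered {J H : Type*} [Fintype J] [DecidableEq J] [Fintype H]
    [DecidableEq H] (h0 : H) (j0 : J) (a : ℝ) (b : J → H → ℝ) (hb : ∀ j, ∑ h, b j h = 0)
    {s : ℝ} (hs : 0 < s) (hs1 : s ≤ 1 / 8) (hK : (2 : ℝ) ^ 14 ≤ Fintype.card H)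
    (hn : s * Fintype.card J ≤ (Fintype.card H : ℝ) / 8) :
    ∑ g : J → H, ((if g j0 = h0 then 1 else 0) *
        ∏ j, if g j = h0 then Real.exp (-s) else 1) * (a + ∑ j, b j (g j)) ^ 2 ≤
      Real.exp (-s * (Fintype.card J / Fintype.card H + 3 / 4)) *
        ∑ g : J → H, (a + ∑ j, b j (g j)) ^ 2 := by
  set K : ℝ := ((Fintype.card H : ℕ) : ℝ) with hKdef
  set e := Real.exp (-s) with he
  have he0 : 0 < e := Real.exp_pos _
  have he1 : e ≤ 1 := Real.exp_le_one_iff.2 (by linarith)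
  have hed : 1 - e ≤ s := by have := Real.add_one_le_exp (-s); linarith
  have hK0 : 0 < K := lt_of_lt_of_le (by norm_num) hK
  set Q := K - (1 - e) with hQ
  have hKbig : (1000 : ℝ) ≤ K := le_trans (by norm_num) hK
  have hQ0 : 0 < Q := by linarith
  have hKQ : K / Q ≤ 101 / 100 := by rw [div_le_iff₀ hQ0]; linarith
  have hKQ1 : 1 ≤ K / Q := by rw [le_div_iff₀ hQ0]; linarith
  set J' := Finset.univ.erase j0 with hJ'
  have hcard : (J'.card : ℝ) + 1 = Fintype.card J := by
    exact_mod_cast Finset.card_erase_add_one (Finset.mem_univ j0)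
  set B : J → ℝ := fun j => ∑ h, b j h ^ 2 with hB
  have hB0 : ∀ j, 0 ≤ B j := fun j => Finset.sum_nonneg fun h _ => sq_nonneg _
  -- the right-hand side, by orthogonality
  have hR : ∑ g : J → H, (a + ∑ j, b j (g j)) ^ 2 =
      K ^ J'.card * (K * a ^ 2 + ∑ j, B j) := by
    have h1 := sum_prod_weights_sq (W := fun (_ : J) (_ : H) => 1 / K)
      (by intro j; simp [← hKdef, hK0.ne']) a (b := b)
      (by intro j; rw [← Finset.mul_sum, hb, mul_zero])
    simp only [Finset.prod_const, ← Finset.mul_sum] at h1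
    have h2 : (Finset.univ : Finset J).card = J'.card + 1 :=
      (Finset.card_erase_add_one (Finset.mem_univ j0)).symm
    rw [h2] at h1
    have h3 : (1 / K) ^ (J'.card + 1) * K ^ (J'.card + 1) = 1 := by
      rw [← mul_pow, one_div_mul_cancel hK0.ne', one_pow]
    calc _ = (1 / K) ^ (J'.card + 1) * K ^ (J'.card + 1) *
          ∑ g : J → H, (a + ∑ j, b j (g j)) ^ 2 := by rw [h3, one_mul]
      _ = K ^ (J'.card + 1) * ((1 / K) ^ (J'.card + 1) *
          ∑ g : J → H, (a + ∑ j, b j (g j)) ^ 2) := by ring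
      _ = _ := by
        rw [h1, pow_succ]
        field_simp
        rfl
  -- the left-hand side, by tilting the uniform measure
  set W : J → H → ℝ := fun j h => if j = j0 then (if h = h0 then 1 else 0) else
    (if h = h0 then e else 1) / Q with hWdef
  have hite : ∀ u : H → ℝ, ∑ h, (if h = h0 then e else 1) * u h =
      ∑ h, u h - (1 - e) * u h0 := by
    intro u
    have : ∀ h, (if h = h0 then e else 1) * u h =
        u h - if h = h0 then (1 - e) * u h else 0 := by
      intro h; split_ifs <;> ring
    simp_rw [this, Finset.sum_sub_distrib]
    simp
  have hW : ∀ j, ∑ h, W j h = 1 := by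
    intro j
    by_cases hj : j = j0
    · simp [hWdef, hj]
    · simp only [hWdef, hj, if_false]
      rw [← Finset.sum_div, div_eq_one_iff_eq hQ0.ne']
      have := hite fun _ => 1
      simp only [mul_one] at this
      rw [this]
      simp [hQ, ← hKdef]
  set m : J → ℝ := fun j => if j = j0 then b j h0 else -(1 - e) * b j h0 / Q with hmdef
  have hm : ∀ j, ∑ h, W j h * b j h = m j := by
    intro j
    by_cases hj : j = j0
    · simp [hWdef, hmdef, hj]
    · simp only [hWdef, hmdef, hj, if_false, div_mul_eq_mul_div]
      rw [← Finset.sum_div, hite, hb]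
      ring
  have hV : ∀ j ∈ J', ∑ h, W j h * b j h ^ 2 - m j ^ 2 ≤ B j / Q := by
    intro j hj
    have hj : j ≠ j0 := (Finset.mem_erase.1 hj).1
    have : ∑ h, W j h * b j h ^ 2 ≤ B j / Q := by
      simp only [hWdef, hj, if_false, div_mul_eq_mul_div]
      rw [← Finset.sum_div, hite]
      gcongr
      nlinarith [sq_nonneg (b j h0)]
    linarith [sq_nonneg (m j)]
  have hL : ∑ g : J → H, ((if g j0 = h0 then 1 else 0) * ∏ j, if g j = h0 then e else 1) *
      (a + ∑ j, b j (g j)) ^ 2 = e * Q ^ J'.card * ((a + b j0 h0 + ∑ j ∈ J', m j) ^ 2 +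
        ∑ j ∈ J', (∑ h, W j h * b j h ^ 2 - m j ^ 2)) := by
    have h1 := sum_prod_weights_sq_of_mean hW a b m hm
    rw [← Finset.add_sum_erase _ m (Finset.mem_univ j0),
      ← Finset.add_sum_erase _ (fun j => ∑ h, W j h * b j h ^ 2 - m j ^ 2)
        (Finset.mem_univ j0)] at h1
    have h2 : ∑ h, W j0 h * b j0 h ^ 2 - m j0 ^ 2 = 0 := by simp [hWdef, hmdef]
    have h3 : m j0 = b j0 h0 := by simp [hmdef]
    rw [h2, zero_add, h3, ← add_assoc a] at h1
    rw [← h1, Finset.mul_sum]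
    refine Finset.sum_congr rfl fun g _ => ?_
    rw [← mul_assoc]
    congr 1
    rw [← Finset.mul_prod_erase _ (fun j => if g j = h0 then e else 1) (Finset.mem_univ j0),
      ← Finset.mul_prod_erase _ (fun j => W j (g j)) (Finset.mem_univ j0)]
    have h4 : ∏ j ∈ J', W j (g j) = (∏ j ∈ J', if g j = h0 then e else 1) / Q ^ J'.card := by
      rw [← Finset.prod_const, ← Finset.prod_div_distrib]
      refine Finset.prod_congr rfl fun j hj => ?_
      simp [hWdef, (Finset.mem_erase.1 hj).1]
    rw [h4]
    by_cases hg : g j0 = h0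
    · simp only [hg, hWdef, if_true, ← hJ']
      field_simp
    · simp [hg, hWdef]
  rw [hL, hR]
  -- bounds on mean and variance under the tilted measure
  have hpt : ∀ j, b j h0 ^ 2 ≤ B j := fun j =>
    Finset.single_le_sum (f := fun h => b j h ^ 2) (fun h _ => sq_nonneg _) (Finset.mem_univ h0)
  set B' := ∑ j ∈ J', B j with hB'
  have hB'0 : 0 ≤ B' := Finset.sum_nonneg fun j _ => hB0 j
  have hA : (a + b j0 h0) ^ 2 ≤ K * a ^ 2 + B j0 := by
    calc (a + b j0 h0) ^ 2 ≤ ∑ h, (a + b j0 h) ^ 2 :=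
          Finset.single_le_sum (f := fun h => (a + b j0 h) ^ 2) (fun h _ => sq_nonneg _)
            (Finset.mem_univ h0)
      _ = _ := by
        have : ∀ h, (a + b j0 h) ^ 2 = a ^ 2 + 2 * a * b j0 h + b j0 h ^ 2 := by intro h; ring
        simp_rw [this, Finset.sum_add_distrib, ← Finset.mul_sum, hb]
        simp [hB, ← hKdef]
  have hM : (∑ j ∈ J', m j) ^ 2 ≤ s ^ 2 * Fintype.card J / Q ^ 2 * B' := by
    calc (∑ j ∈ J', m j) ^ 2 ≤ J'.card * ∑ j ∈ J', m j ^ 2 := sq_sum_le_card_mul_sum_sq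
      _ ≤ Fintype.card J * ∑ j ∈ J', s ^ 2 / Q ^ 2 * B j := by
        gcongr with j hj
        · exact Finset.card_le_univ J'
        · simp only [hmdef, (Finset.mem_erase.1 hj).1, if_false]
          rw [div_pow, mul_pow, neg_sq, div_mul_eq_mul_div]
          gcongr
          exact hpt j
      _ = _ := by rw [← Finset.mul_sum]; ring
  have hMM : (1 + 16 / s) * (∑ j ∈ J', m j) ^ 2 ≤ 3 / K * B' := by
    calc (1 + 16 / s) * (∑ j ∈ J', m j) ^ 2
        ≤ (1 + 16 / s) * (s ^ 2 * Fintype.card J / Q ^ 2 * B') := by gcongr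
      _ = (s + 16) * (s * Fintype.card J) / Q ^ 2 * B' := by field_simp
      _ ≤ 17 * (K / 8) / Q ^ 2 * B' := by gcongr; linarith
      _ = 17 / 8 * (K / Q) ^ 2 / K * B' := by field_simp
      _ ≤ 17 / 8 * (101 / 100) ^ 2 / K * B' := by gcongr
      _ ≤ _ := by gcongr; norm_num
  have hbr : (a + b j0 h0 + ∑ j ∈ J', m j) ^ 2 +
      ∑ j ∈ J', (∑ h, W j h * b j h ^ 2 - m j ^ 2) ≤ (1 + s / 16) * (K * a ^ 2 + ∑ j, B j) := by
    have h1 : ∑ j ∈ J', (∑ h, W j h * b j h ^ 2 - m j ^ 2) ≤ B' / Q := by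
      rw [hB', Finset.sum_div]
      exact Finset.sum_le_sum hV
    have h2 : ∑ j, B j = B j0 + B' := (Finset.add_sum_erase _ _ (Finset.mem_univ j0)).symm
    -- Young's inequality, weighted so that the main term loses only a factor `1 + s / 16`
    have h3 : (a + b j0 h0 + ∑ j ∈ J', m j) ^ 2 ≤ (1 + s / 16) * (a + b j0 h0) ^ 2 +
        (1 + 16 / s) * (∑ j ∈ J', m j) ^ 2 := by
      set u := a + b j0 h0
      set v := ∑ j ∈ J', m j
      have : (1 + s / 16) * u ^ 2 + (1 + 16 / s) * v ^ 2 - (u + v) ^ 2 =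
          s / 16 * (u - 16 / s * v) ^ 2 := by field_simp; ring
      have h4 : 0 ≤ s / 16 * (u - 16 / s * v) ^ 2 := by positivity
      linarith
    have h4 : 3 / K * B' + B' / Q ≤ B' := by
      have h5 : B' / Q = (K / Q) / K * B' := by field_simp
      rw [h5, ← add_mul]
      have h6 : 3 / K + K / Q / K ≤ 1 := by
        rw [← add_div, div_le_one hK0]; linarith
      exact mul_le_of_le_one_left hB'0 h6
    rw [h2]
    have h7 : (1 + s / 16) * (a + b j0 h0) ^ 2 ≤ (1 + s / 16) * (K * a ^ 2 + B j0) := by gcongr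
    have h8 : B' ≤ (1 + s / 16) * B' := le_mul_of_one_le_left hB'0 (by linarith)
    linarith
  have hfac := block_factor_le hs hs1 hK (n := Fintype.card J) (by linarith) J'.card hcard
  have hS : 0 ≤ K * a ^ 2 + ∑ j, B j :=
    add_nonneg (by positivity) (Finset.sum_nonneg fun j _ => hB0 j)
  calc e * Q ^ J'.card * ((a + b j0 h0 + ∑ j ∈ J', m j) ^ 2 +
        ∑ j ∈ J', (∑ h, W j h * b j h ^ 2 - m j ^ 2))
      ≤ e * Q ^ J'.card * ((1 + s / 16) * (K * a ^ 2 + ∑ j, B j)) := by gcongr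
    _ = e * Q ^ J'.card * (1 + s / 16) * (K * a ^ 2 + ∑ j, B j) := by ring
    _ ≤ Real.exp (-s * (Fintype.card J / K + 3 / 4)) * K ^ J'.card *
        (K * a ^ 2 + ∑ j, B j) := by gcongr
    _ = _ := by ring

/-- A function of degree at most one on `J → H` cannot concentrate on the `g` with `g j0 = h0` and
few other coordinates equal to `h0`. The number of coordinates equal to `h0` behaves under its
square, restricted to `g j0 = h0`, like `1 + card J / card H` rather than like the uniform mean
`card J / card H`. The loss of `1 / 4` in the exponent covers all error terms. -/
theorem block_bound {J H : Type*} [Fintype J] [DecidableEq J] [Fintype H]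
    [DecidableEq H] (h0 : H) (j0 : J) (a : ℂ) (b : J → H → ℂ)
    {s : ℝ} (hs : 0 < s) (hs1 : s ≤ 1 / 8) (hK : (2 : ℝ) ^ 14 ≤ Fintype.card H)
    (hn : s * Fintype.card J ≤ (Fintype.card H : ℝ) / 8) :
    ∑ g : J → H, ((if g j0 = h0 then 1 else 0) *
        ∏ j, if g j = h0 then Real.exp (-s) else 1) * ‖a + ∑ j, b j (g j)‖ ^ 2 ≤
      Real.exp (-s * (Fintype.card J / Fintype.card H + 3 / 4)) *
        ∑ g : J → H, ‖a + ∑ j, b j (g j)‖ ^ 2 := by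
  have hK0 : (Fintype.card H : ℝ) ≠ 0 := (lt_of_lt_of_le (by norm_num) hK).ne'
  -- subtract the means, and treat real and imaginary parts separately
  have key : ∀ (a : ℝ) (b : J → H → ℝ), ∑ g : J → H, ((if g j0 = h0 then 1 else 0) *
        ∏ j, if g j = h0 then Real.exp (-s) else 1) * (a + ∑ j, b j (g j)) ^ 2 ≤
      Real.exp (-s * (Fintype.card J / Fintype.card H + 3 / 4)) *
        ∑ g : J → H, (a + ∑ j, b j (g j)) ^ 2 := by
    intro a b
    set m : J → ℝ := fun j => (∑ h, b j h) / Fintype.card H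
    have h1 := block_bound_of_centered h0 j0 (a + ∑ j, m j) (fun j h => b j h - m j)
      (by intro j; simp [m]; field_simp; simp) hs hs1 hK hn
    have h2 : ∀ g : J → H, a + ∑ j, m j + ∑ j, (b j (g j) - m j) = a + ∑ j, b j (g j) := by
      intro g
      rw [Finset.sum_sub_distrib]
      ring
    simpa only [h2] using h1
  have hsq : ∀ g : J → H, ‖a + ∑ j, b j (g j)‖ ^ 2 =
      (a.re + ∑ j, (b j (g j)).re) ^ 2 + (a.im + ∑ j, (b j (g j)).im) ^ 2 := by
    intro g
    rw [Complex.sq_norm, Complex.normSq_apply]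
    simp
    ring
  generalize Real.exp (-s * (Fintype.card J / Fintype.card H + 3 / 4)) = μ at key ⊢
  simp_rw [hsq, mul_add, Finset.sum_add_distrib, mul_add]
  exact add_le_add (key a.re fun j h => (b j h).re) (key a.im fun j h => (b j h).im)

/-! ### Slicing a sum along blocks of coordinates -/

/-- The function on `ι` given by `g` on `J` and by `r` off `J`. -/
def glue {ι H : Type*} [DecidableEq ι] (J : Finset ι) (g : {x // x ∈ J} → H)
    (r : {x // x ∉ J} → H) : ι → H :=
  (Equiv.piEquivPiSubtypeProd (· ∈ J) fun _ => H).symm (g, r)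

theorem glue_of_mem {ι H : Type*} [DecidableEq ι] {J : Finset ι} (g : {x // x ∈ J} → H)
    (r : {x // x ∉ J} → H) {x : ι} (hx : x ∈ J) : glue J g r x = g ⟨x, hx⟩ := by
  simp [glue, Equiv.piEquivPiSubtypeProd, hx]

theorem glue_of_notMem {ι H : Type*} [DecidableEq ι] {J : Finset ι} (g : {x // x ∈ J} → H)
    (r : {x // x ∉ J} → H) {x : ι} (hx : x ∉ J) : glue J g r x = r ⟨x, hx⟩ := by
  simp [glue, Equiv.piEquivPiSubtypeProd, hx]

theorem sum_eq_sum_glue {ι H : Type*} [Fintype ι] [DecidableEq ι] [Fintype H] (J : Finset ι)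
    (F : (ι → H) → ℝ) :
    ∑ f, F f = ∑ r : {x // x ∉ J} → H, ∑ g : {x // x ∈ J} → H, F (glue J g r) := by
  rw [← (Equiv.piEquivPiSubtypeProd (· ∈ J) fun _ => H).symm.sum_comp, Fintype.sum_prod_type_right]
  rfl

theorem prod_glue {ι H N : Type*} [DecidableEq ι] [CommMonoid N] (J : Finset ι)
    (g : {x // x ∈ J} → H) (r : {x // x ∉ J} → H) (u : ι → H → N) :
    ∏ x ∈ J, u x (glue J g r x) = ∏ x : {x // x ∈ J}, u x (g x) := by
  rw [← Finset.prod_coe_sort]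
  exact Finset.prod_congr rfl fun x _ => by rw [glue_of_mem g r x.2]

/-- Bounds for weights on disjoint blocks multiply: each is applied with all coordinates outside its
block fixed. This replaces the multiplicativity of the operator norm under tensor products. -/
theorem sum_prod_blocks_le {ι H κ : Type*} [Fintype ι] [DecidableEq ι] [Fintype H]
    [DecidableEq κ] (I : Finset κ) (J : κ → Finset ι)
    (hJ : ∀ i j, i ≠ j → Disjoint (J i) (J j)) (w : κ → (ι → H) → ℝ) (hw0 : ∀ i f, 0 ≤ w i f)
    (hw : ∀ i f f', (∀ x ∈ J i, f x = f' x) → w i f = w i f') (μ : κ → ℝ) (hμ : ∀ i, 0 ≤ μ i)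
    (F : (ι → H) → ℝ)
    (hF : ∀ i r, ∑ g, w i (glue (J i) g r) * F (glue (J i) g r) ≤
      μ i * ∑ g, F (glue (J i) g r)) :
    ∑ f, (∏ i ∈ I, w i f) * F f ≤ (∏ i ∈ I, μ i) * ∑ f, F f := by
  induction I using Finset.induction_on with
  | empty => simp
  | insert i I hi ih =>
    rw [Finset.prod_insert hi]
    calc ∑ f, (∏ j ∈ insert i I, w j f) * F f
        ≤ μ i * ∑ f, (∏ j ∈ I, w j f) * F f := by
          rw [sum_eq_sum_glue (J i), sum_eq_sum_glue (J i), Finset.mul_sum]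
          refine Finset.sum_le_sum fun r _ => ?_
          rcases isEmpty_or_nonempty ({x // x ∈ J i} → H) with h | ⟨⟨g₀⟩⟩
          · simp
          -- the weights of the other blocks do not depend on the coordinates in `J i`
          have h1 : ∀ g, ∏ j ∈ I, w j (glue (J i) g r) = ∏ j ∈ I, w j (glue (J i) g₀ r) := by
            intro g
            refine Finset.prod_congr rfl fun j hj => hw j _ _ fun x hx => ?_
            have hne : i ≠ j := by rintro rfl; exact hi hj
            have hx' : x ∉ J i := fun h => Finset.disjoint_left.1 (hJ i j hne) h hx
            rw [glue_of_notMem _ _ hx', glue_of_notMem _ _ hx']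
          simp_rw [Finset.prod_insert hi, h1]
          calc ∑ g, w i (glue (J i) g r) * (∏ j ∈ I, w j (glue (J i) g₀ r)) * F (glue (J i) g r)
              = (∏ j ∈ I, w j (glue (J i) g₀ r)) *
                  ∑ g, w i (glue (J i) g r) * F (glue (J i) g r) := by
                rw [Finset.mul_sum]
                exact Finset.sum_congr rfl fun g _ => by ring
            _ ≤ (∏ j ∈ I, w j (glue (J i) g₀ r)) * (μ i * ∑ g, F (glue (J i) g r)) := by
                gcongr
                · exact Finset.prod_nonneg fun j _ => hw0 j _
                · exact hF i r
            _ = _ := by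
                simp_rw [Finset.mul_sum]
                exact Finset.sum_congr rfl fun g _ => by ring
      _ ≤ μ i * ((∏ j ∈ I, μ j) * ∑ f, F f) := by
          gcongr
          exact hμ i
      _ = _ := by ring

/-! ### Zeros of functions on disjoint blocks -/

/-- The number of points of the blocks `J i` at which `f` takes the value `h0`. -/
def hits {ι H κ : Type*} [DecidableEq H] [Fintype κ] (J : κ → Finset ι) (h0 : H)
    (f : ι → H) : ℕ :=
  ∑ i, ((J i).filter fun x => f x = h0).card

/-- The threshold for `hits`: halfway, per block, between the expected number of hits of a uniform
function and that of a function conditioned on one hit. -/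
def hitBound {ι κ : Type*} (H : Type*) [Fintype H] [Fintype κ] (J : κ → Finset ι) : ℝ :=
  ∑ i, (((J i).card : ℝ) / Fintype.card H + 1 / 2)

theorem exp_hits {ι H κ : Type*} [DecidableEq H] [Fintype κ] (J : κ → Finset ι) (h0 : H)
    (f : ι → H) (s : ℝ) :
    Real.exp (s * hits J h0 f) = ∏ i, ∏ x ∈ J i, if f x = h0 then Real.exp s else 1 := by
  simp_rw [hits, Finset.prod_ite, Finset.prod_const, one_pow, mul_one, ← Real.exp_nat_mul,
    ← Real.exp_sum]
  push_cast
  rw [Finset.mul_sum]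
  simp_rw [mul_comm]

/-- `block_bound`, multiplied over all blocks. -/
theorem sum_hit_weights_le {ι H κ : Type*} [Fintype ι] [DecidableEq ι] [Fintype H] [DecidableEq H]
    [Fintype κ] [DecidableEq κ] (J : κ → Finset ι) (hJ : ∀ i j, i ≠ j → Disjoint (J i) (J j))
    (h0 : H) (t : κ → ι) (ht : ∀ i, t i ∈ J i) (Ψ : (ι → H) → ℂ)
    (hΨ : ∀ i r, ∃ (a : ℂ) (b : {x // x ∈ J i} → H → ℂ), ∀ g,
      Ψ (glue (J i) g r) = a + ∑ x, b x (g x))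
    {s : ℝ} (hs : 0 < s) (hs1 : s ≤ 1 / 8) (hK : (2 : ℝ) ^ 14 ≤ Fintype.card H)
    (hn : ∀ i, s * (J i).card ≤ (Fintype.card H : ℝ) / 8) :
    ∑ f, (∏ i, ((if f (t i) = h0 then 1 else 0) *
        ∏ x ∈ J i, if f x = h0 then Real.exp (-s) else 1)) * ‖Ψ f‖ ^ 2 ≤
      (∏ i, Real.exp (-s * (((J i).card : ℝ) / Fintype.card H + 3 / 4))) * ∑ f, ‖Ψ f‖ ^ 2 := by
  refine sum_prod_blocks_le Finset.univ J hJ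
    (fun i f => (if f (t i) = h0 then 1 else 0) *
        ∏ x ∈ J i, if f x = h0 then Real.exp (-s) else 1) ?_ ?_ _ (fun i => (Real.exp_pos _).le)
    (fun f => ‖Ψ f‖ ^ 2) ?_
  · intro i f
    refine mul_nonneg (by split_ifs <;> norm_num) (Finset.prod_nonneg fun x _ => ?_)
    split_ifs <;> positivity
  · intro i f f' h
    rw [h _ (ht i)]
    congr 1
    exact Finset.prod_congr rfl fun x hx => by rw [h x hx]
  · intro i r
    obtain ⟨a, b, hab⟩ := hΨ i r
    have h1 := block_bound h0 (⟨t i, ht i⟩ : {x // x ∈ J i}) a b hs hs1 hK (by simpa using hn i)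
    simp only [Fintype.card_coe] at h1
    simp_rw [hab, glue_of_mem _ _ (ht i),
      prod_glue (J i) _ r fun _ h => if h = h0 then Real.exp (-s) else 1]
    exact h1

/-- A function of degree at most one in each block has little mass on the functions with
few hits, one of them at a prescribed point of each block. -/
theorem sum_few_hits_le {ι H κ : Type*} [Fintype ι] [DecidableEq ι] [Fintype H] [DecidableEq H]
    [Fintype κ] [DecidableEq κ] (J : κ → Finset ι) (hJ : ∀ i j, i ≠ j → Disjoint (J i) (J j))
    (h0 : H) (t : κ → ι) (ht : ∀ i, t i ∈ J i) (Ψ : (ι → H) → ℂ)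
    (hΨ : ∀ i r, ∃ (a : ℂ) (b : {x // x ∈ J i} → H → ℂ), ∀ g,
      Ψ (glue (J i) g r) = a + ∑ x, b x (g x))
    {s : ℝ} (hs : 0 < s) (hs1 : s ≤ 1 / 8) (hK : (2 : ℝ) ^ 14 ≤ Fintype.card H)
    (hn : ∀ i, s * (J i).card ≤ (Fintype.card H : ℝ) / 8) :
    ∑ f, (if (hits J h0 f : ℝ) ≤ hitBound H J ∧ ∀ i, f (t i) = h0 then ‖Ψ f‖ ^ 2 else 0) ≤
      Real.exp (-(s * Fintype.card κ / 4)) * ∑ f, ‖Ψ f‖ ^ 2 := by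
  have h1 := sum_hit_weights_le J hJ h0 t ht Ψ hΨ hs hs1 hK hn
  have h2 : Real.exp (s * hitBound H J) *
      (∏ i, Real.exp (-s * (((J i).card : ℝ) / Fintype.card H + 3 / 4))) =
      Real.exp (-(s * Fintype.card κ / 4)) := by
    rw [← Real.exp_sum, ← Real.exp_add, hitBound, Finset.mul_sum, ← Finset.sum_add_distrib]
    congr 1
    rw [Finset.sum_congr rfl fun i _ => show _ = -(s / 4) by ring]
    simp
    ring
  calc _ ≤ ∑ f, Real.exp (s * hitBound H J) * ((∏ i, ((if f (t i) = h0 then 1 else 0) *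
        ∏ x ∈ J i, if f x = h0 then Real.exp (-s) else 1)) * ‖Ψ f‖ ^ 2) := by
        refine Finset.sum_le_sum fun f _ => ?_
        rw [Finset.prod_mul_distrib, ← exp_hits]
        split_ifs with h
        · simp only [h.2, if_true, Finset.prod_const_one, one_mul]
          rw [← mul_assoc, ← Real.exp_add]
          refine le_mul_of_one_le_left (sq_nonneg _) (Real.one_le_exp ?_)
          nlinarith [h.1]
        · refine mul_nonneg (Real.exp_pos _).le (mul_nonneg (mul_nonneg
            (Finset.prod_nonneg fun i _ => ?_) (Real.exp_pos _).le) (sq_nonneg _))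
          split_ifs <;> norm_num
    _ ≤ _ := by
        rw [← Finset.mul_sum, ← h2, mul_assoc]
        exact mul_le_mul_of_nonneg_left h1 (Real.exp_pos _).le

/-- Chernoff bound: few functions have many hits. -/
theorem card_many_hits_le {ι H κ : Type*} [Fintype ι] [DecidableEq ι] [Fintype H] [DecidableEq H]
    [Fintype κ] [DecidableEq κ] (J : κ → Finset ι) (hJ : ∀ i j, i ≠ j → Disjoint (J i) (J j))
    (h0 : H) {s : ℝ} (hs : 0 < s) (hs1 : s ≤ 1 / 8) (hK : (2 : ℝ) ^ 14 ≤ Fintype.card H)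
    (hn : ∀ i, s * (J i).card ≤ (Fintype.card H : ℝ) / 8) :
    ∑ f : ι → H, (if (hits J h0 f : ℝ) ≤ hitBound H J then (0 : ℝ) else 1) ≤
      Real.exp (-(s * Fintype.card κ / 4)) * (Fintype.card H : ℝ) ^ Fintype.card ι := by
  have hK0 : (0 : ℝ) < Fintype.card H := lt_of_lt_of_le (by norm_num) hK
  have hsum : ∑ h : H, (if h = h0 then Real.exp s else 1) =
      Fintype.card H + (Real.exp s - 1) := by
    have : ∀ h, (if h = h0 then Real.exp s else 1) =
        1 + if h = h0 then (Real.exp s - 1) else 0 := by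
      intro h; split_ifs <;> ring
    simp_rw [this, Finset.sum_add_distrib]
    simp
  have hexp : Real.exp s - 1 ≤ s + s ^ 2 := by
    have := (abs_le.1 (Real.abs_exp_sub_one_sub_id_le (x := s)
      (abs_le.2 ⟨by linarith, by linarith⟩))).2
    linarith
  have h1 := sum_prod_blocks_le Finset.univ J hJ
    (fun i f => ∏ x ∈ J i, if f x = h0 then Real.exp s else 1) (by
      intro i f
      refine Finset.prod_nonneg fun x _ => ?_
      split_ifs <;> positivity) (by
      intro i f f' h
      exact Finset.prod_congr rfl fun x hx => by rw [h x hx])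
    (fun i => Real.exp (s * (((J i).card : ℝ) / Fintype.card H + 1 / 4)))
    (fun i => (Real.exp_pos _).le) (fun _ => (1 : ℝ)) (by
      intro i r
      simp_rw [mul_one, prod_glue (J i) _ r fun _ h => if h = h0 then Real.exp s else 1]
      have h2 := Finset.prod_univ_sum (fun _ : {x // x ∈ J i} => (Finset.univ : Finset H))
        (fun _ h => if h = h0 then Real.exp s else 1)
      rw [Fintype.piFinset_univ] at h2
      rw [← h2, hsum]
      simp only [Finset.prod_const, Finset.card_univ, Fintype.card_coe, Finset.sum_const,
        Fintype.card_fun, nsmul_eq_mul, mul_one]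
      push_cast
      have h3 : (Fintype.card H : ℝ) + (Real.exp s - 1) ≤
          Real.exp ((s + s ^ 2) / Fintype.card H) * Fintype.card H := by
        have := Real.add_one_le_exp ((s + s ^ 2) / Fintype.card H)
        calc (Fintype.card H : ℝ) + (Real.exp s - 1) ≤ Fintype.card H + (s + s ^ 2) := by gcongr
          _ = ((s + s ^ 2) / Fintype.card H + 1) * Fintype.card H := by field_simp; ring
          _ ≤ _ := by gcongr
      have h4 : (0 : ℝ) ≤ (Fintype.card H : ℝ) + (Real.exp s - 1) := by
        have := Real.one_le_exp hs.le
        linarith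
      calc ((Fintype.card H : ℝ) + (Real.exp s - 1)) ^ (J i).card
          ≤ (Real.exp ((s + s ^ 2) / Fintype.card H) * Fintype.card H) ^ (J i).card := by gcongr
        _ = Real.exp ((J i).card * ((s + s ^ 2) / Fintype.card H)) *
              (Fintype.card H : ℝ) ^ (J i).card := by rw [mul_pow, Real.exp_nat_mul]
        _ ≤ _ := by
          refine mul_le_mul_of_nonneg_right (Real.exp_le_exp.2 ?_) (by positivity)
          have h5 : s * (J i).card / Fintype.card H ≤ 1 / 8 := by
            rw [div_le_iff₀ hK0]
            have := hn i
            linarith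
          calc ((J i).card : ℝ) * ((s + s ^ 2) / Fintype.card H) =
                s * ((J i).card / Fintype.card H) + s * (s * (J i).card / Fintype.card H) := by
                ring
            _ ≤ s * ((J i).card / Fintype.card H) + s * (1 / 8) := by gcongr
            _ ≤ _ := by linarith)
  simp only [mul_one, Finset.sum_const, Finset.card_univ, Fintype.card_fun, nsmul_eq_mul] at h1
  push_cast at h1
  have h2 : Real.exp (-(s * hitBound H J)) *
      (∏ i, Real.exp (s * (((J i).card : ℝ) / Fintype.card H + 1 / 4))) =
      Real.exp (-(s * Fintype.card κ / 4)) := by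
    rw [← Real.exp_sum, ← Real.exp_add, hitBound, Finset.mul_sum, ← Finset.sum_neg_distrib,
      ← Finset.sum_add_distrib]
    congr 1
    rw [Finset.sum_congr rfl fun i _ => show _ = -(s / 4) by ring]
    simp
    ring
  calc _ ≤ ∑ f : ι → H, Real.exp (-(s * hitBound H J)) *
        ∏ i, ∏ x ∈ J i, (if f x = h0 then Real.exp s else 1) := by
        refine Finset.sum_le_sum fun f _ => ?_
        rw [← exp_hits, ← Real.exp_add]
        split_ifs with h
        · positivity
        · refine Real.one_le_exp ?_
          nlinarith [not_le.1 h]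
    _ ≤ _ := by
        rw [← Finset.mul_sum, ← h2, mul_assoc]
        exact mul_le_mul_of_nonneg_left h1 (Real.exp_pos _).le

/-! ### The compressed oracle in the uncompressed picture -/

/-- The amplitude `2^(-l/2)` of each string in `|+^l⟩`. -/
def amp (l : ℕ) : ℂ := ((1 / Real.sqrt (2 ^ l) : ℝ) : ℂ)

theorem amp_mul_self (l : ℕ) : amp l * amp l * 2 ^ l = 1 := by
  rw [amp, ← Complex.ofReal_mul, div_mul_div_comm, Real.mul_self_sqrt (by positivity)]
  push_cast
  field_simp

theorem norm_amp_sq (l : ℕ) : ‖amp l‖ ^ 2 = 1 / 2 ^ l := by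
  rw [amp, Complex.norm_real, Real.norm_eq_abs, sq_abs, div_pow, one_pow,
    Real.sq_sqrt (by positivity)]

theorem comp_none_none (l : ℕ) : comp l none none = 0 := by
  simp [comp, plusVec, botVec, Matrix.vecMulVec_apply]

theorem comp_none_some (l : ℕ) (h : Hash l) : comp l none (some h) = amp l := by
  simp [comp, plusVec, botVec, Matrix.vecMulVec_apply, amp]

theorem comp_some_none (l : ℕ) (h : Hash l) : comp l (some h) none = amp l := by
  simp [comp, plusVec, botVec, Matrix.vecMulVec_apply, amp]

theorem comp_some_some (l : ℕ) (h h' : Hash l) :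
    comp l (some h) (some h') = (if h = h' then 1 else 0) - amp l * amp l := by
  simp [comp, plusVec, botVec, Matrix.vecMulVec_apply, amp, Matrix.one_apply]

theorem card_hash (l : ℕ) : Fintype.card (Hash l) = 2 ^ l := by
  simp [Hash]

theorem comp_mul_comp (l : ℕ) : comp l * comp l = 1 := by
  have h2 := amp_mul_self l
  ext d d'
  rw [Matrix.mul_apply, Fintype.sum_option]
  rcases d with _ | h <;> rcases d' with _ | h'
  · simp only [comp_none_none, comp_none_some, comp_some_none, Finset.sum_const, Finset.card_univ,
      card_hash, nsmul_eq_mul, Matrix.one_apply_eq]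
    push_cast
    linear_combination h2
  · simp only [comp_none_none, comp_none_some, comp_some_some, mul_sub, Finset.sum_sub_distrib,
      Finset.sum_const, Finset.card_univ, card_hash, nsmul_eq_mul]
    simp
    linear_combination (-amp l) * h2
  · simp only [comp_none_none, comp_some_none, comp_some_some, sub_mul, Finset.sum_sub_distrib,
      Finset.sum_const, Finset.card_univ, card_hash, nsmul_eq_mul]
    simp
    linear_combination (-amp l) * h2
  · simp only [comp_none_some, comp_some_none, comp_some_some, sub_mul, mul_sub,
      Finset.sum_sub_distrib, Finset.sum_const, Finset.card_univ, card_hash, nsmul_eq_mul]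
    simp [Matrix.one_apply]
    linear_combination (amp l * amp l) * h2

theorem star_comp (l : ℕ) (d d' : Option (Hash l)) : star (comp l d d') = comp l d' d := by
  have : star (amp l) = amp l := Complex.conj_ofReal _
  rcases d with _ | h <;> rcases d' with _ | h'
  · simp [comp_none_none]
  · rw [comp_none_some, comp_some_none, this]
  · rw [comp_none_some, comp_some_none, this]
  · rw [comp_some_some, comp_some_some, star_sub, star_mul', this]
    simp [eq_comm, apply_ite star]

theorem sum_norm_sq_mulVec {ι : Type*} [Fintype ι] [DecidableEq ι] {U : Matrix ι ι ℂ}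
    (hU : star U * U = 1) (v : ι → ℂ) : ∑ i, ‖U.mulVec v i‖ ^ 2 = ∑ i, ‖v i‖ ^ 2 := by
  have h1 : ∀ w : ι → ℂ, ((∑ i, ‖w i‖ ^ 2 : ℝ) : ℂ) = star w ⬝ᵥ w := by
    intro w
    simp [dotProduct, Complex.conj_mul']
  have h2 : star (U.mulVec v) ⬝ᵥ U.mulVec v = star v ⬝ᵥ v := by
    rw [Matrix.star_mulVec, ← Matrix.dotProduct_mulVec, Matrix.mulVec_mulVec,
      ← Matrix.star_eq_conjTranspose, hU, Matrix.one_mulVec]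
  rw [← h1, ← h1] at h2
  exact_mod_cast h2

theorem one_kronecker_mulVec_apply {α β : Type*} [Fintype α] [DecidableEq α] [Fintype β]
    (A : Matrix β β ℂ) (v : α × β → ℂ) (a : α) (b : β) :
    ((1 : Matrix α α ℂ) ⊗ₖ A).mulVec v (a, b) = A.mulVec (fun b' => v (a, b')) b := by
  simp only [Matrix.mulVec, dotProduct, Fintype.sum_prod_type, Matrix.kroneckerMap_apply]
  rw [Finset.sum_eq_single a]
  · simp
  · intro a' _ h
    simp [Matrix.one_apply_ne h.symm]
  · simp

theorem kronecker_one_mulVec_apply {α β : Type*} [Fintype α] [Fintype β] [DecidableEq β]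
    (A : Matrix α α ℂ) (v : α × β → ℂ) (a : α) (b : β) :
    (A ⊗ₖ (1 : Matrix β β ℂ)).mulVec v (a, b) = A.mulVec (fun a' => v (a', b)) a := by
  simp only [Matrix.mulVec, dotProduct, Fintype.sum_prod_type, Matrix.kroneckerMap_apply]
  refine Finset.sum_congr rfl fun a' _ => ?_
  rw [Finset.sum_eq_single b]
  · simp
  · intro b' _ h
    simp [Matrix.one_apply_ne h.symm]
  · simp

section Oracle

variable (k l : ℕ) (M : Type u₃) (C : Type u₄) (Z : Type u₅) (E : Type u₇)
  [Fintype M] [LinearOrder M] [Fintype C] [LinearOrder C] [Fintype Z] [LinearOrder Z]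
  [Fintype E] [DecidableEq E]

theorem compDB_mul_compDB : compDB k l M C Z * compDB k l M C Z = 1 := by
  ext D D'
  have h1 := Finset.prod_univ_sum
    (fun _ : OracleInput k M C Z => (Finset.univ : Finset (Option (Hash l))))
    (fun x d => comp l (D x) d * comp l d (D' x))
  rw [Fintype.piFinset_univ] at h1
  simp only [Matrix.mul_apply, compDB, Matrix.of_apply, ← Finset.prod_mul_distrib]
  rw [← h1]
  simp_rw [← Matrix.mul_apply, comp_mul_comp]
  rw [Matrix.one_apply]
  split_ifs with h
  · subst h
    exact Finset.prod_eq_one fun x _ => Matrix.one_apply_eq _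
  · obtain ⟨x, hx⟩ := Function.ne_iff.1 h
    exact Finset.prod_eq_zero (Finset.mem_univ x) (Matrix.one_apply_ne hx)

theorem star_compDB_mul_self : star (compDB k l M C Z) * compDB k l M C Z = 1 := by
  have h : star (compDB k l M C Z) = compDB k l M C Z := by
    ext D D'
    rw [Matrix.star_apply]
    simp only [compDB, Matrix.of_apply, star_prod, star_comp]
  rw [h, compDB_mul_compDB]

/-- `Comp` applied to all registers except `D_x`. -/
def compRest (x : OracleInput k M C Z) : Matrix (Database k l M C Z) (Database k l M C Z) ℂ :=
  Matrix.of fun D D' =>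
    if D x = D' x then ∏ x' ∈ Finset.univ.erase x, comp l (D x') (D' x') else 0

theorem sum_ite_eq_off (x : OracleInput k M C Z) (D : Database k l M C Z)
    (F : Database k l M C Z → ℂ) :
    ∑ D', (if ∀ x', x' ≠ x → D' x' = D x' then F D' else 0) =
      ∑ d, F (Function.update D x d) := by
  rw [← Finset.sum_filter]
  symm
  refine Finset.sum_bij (fun d _ => Function.update D x d) ?_ ?_ ?_ (fun _ _ => rfl)
  · intro d _
    simp only [Finset.mem_filter, Finset.mem_univ, true_and]
    exact fun x' hx' => Function.update_of_ne hx' _ _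
  · intro d _ d' _ h
    simpa using congrFun h x
  · intro D' hD'
    refine ⟨D' x, Finset.mem_univ _, ?_⟩
    ext1 x'
    by_cases hx : x' = x
    · subst hx; simp
    · rw [Function.update_of_ne hx]
      exact ((Finset.mem_filter.1 hD').2 x' hx).symm

theorem prod_erase_update (x : OracleInput k M C Z) (D D' : Database k l M C Z)
    (d : Option (Hash l)) :
    ∏ x' ∈ Finset.univ.erase x, comp l (D x') (Function.update D' x d x') =
      ∏ x' ∈ Finset.univ.erase x, comp l (D x') (D' x') :=
  Finset.prod_congr rfl fun x' hx' => by rw [Function.update_of_ne (Finset.mem_erase.1 hx').1]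

theorem compRest_mul_compAt (x : OracleInput k M C Z) :
    compRest k l M C Z x * compAt k l M C Z x = compDB k l M C Z := by
  ext D D'
  simp only [Matrix.mul_apply, compRest, compAt, Matrix.of_apply, mul_ite, mul_zero]
  rw [sum_ite_eq_off]
  simp only [prod_erase_update, Function.update_self, compDB, Matrix.of_apply]
  rw [← Finset.mul_prod_erase _ _ (Finset.mem_univ x)]
  simp [mul_comm]

theorem compDB_mul_compAt (x : OracleInput k M C Z) :
    compDB k l M C Z * compAt k l M C Z x = compRest k l M C Z x := by
  ext D D'
  simp only [Matrix.mul_apply, compDB, compAt, Matrix.of_apply, mul_ite, mul_zero]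
  rw [sum_ite_eq_off]
  simp_rw [← Finset.mul_prod_erase _ _ (Finset.mem_univ x), prod_erase_update,
    Function.update_self, mul_right_comm _ (∏ x' ∈ Finset.univ.erase x, _)]
  rw [← Finset.sum_mul, ← Matrix.mul_apply, comp_mul_comp, Matrix.one_apply]
  simp only [compRest, Matrix.of_apply]
  split_ifs <;> simp

theorem compRest_kronecker_mul_cnotAt (x : OracleInput k M C Z) :
    ((1 : Matrix (Hash l) (Hash l) ℂ) ⊗ₖ compRest k l M C Z x) * cnotAt k l M C Z x =
      cnotAt k l M C Z x * ((1 : Matrix (Hash l) (Hash l) ℂ) ⊗ₖ compRest k l M C Z x) := by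
  ext ⟨y, D⟩ ⟨y', D'⟩
  rw [Matrix.mul_apply, Matrix.mul_apply, Finset.sum_eq_single (y, D'),
    Finset.sum_eq_single (y', D)]
  · simp only [Matrix.kroneckerMap_apply, Matrix.one_apply_eq, one_mul, cnotAt, Matrix.of_apply,
      compRest, true_and]
    by_cases h : D x = D' x <;> simp [h]
  · rintro ⟨y₁, D₁⟩ _ h
    simp only [Matrix.kroneckerMap_apply, cnotAt, Matrix.of_apply, Matrix.one_apply]
    by_cases h1 : y₁ = y'
    · have : D ≠ D₁ := by rintro rfl; exact h (by rw [h1])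
      simp [this]
    · simp [h1]
  · simp
  · rintro ⟨y₁, D₁⟩ _ h
    simp only [Matrix.kroneckerMap_apply, cnotAt, Matrix.of_apply, Matrix.one_apply]
    by_cases h1 : y = y₁
    · have : D₁ ≠ D' := by rintro rfl; exact h (by rw [h1])
      simp [this]
    · simp [h1]
  · simp

/-- In the uncompressed picture a query to `x` is the plain `CNOT`. -/
theorem compDB_kronecker_mul_oracleAt (x : OracleInput k M C Z) :
    ((1 : Matrix (Hash l) (Hash l) ℂ) ⊗ₖ compDB k l M C Z) * oracleAt k l M C Z x =
      cnotAt k l M C Z x * ((1 : Matrix (Hash l) (Hash l) ℂ) ⊗ₖ compDB k l M C Z) := by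
  have h1 := compRest_kronecker_mul_cnotAt k l M C Z x
  rw [oracleAt, ← mul_assoc, ← mul_assoc, ← Matrix.mul_kronecker_mul, mul_one,
    compDB_mul_compAt, h1, mul_assoc, ← Matrix.mul_kronecker_mul, mul_one, compRest_mul_compAt]

end Oracle

section Game

variable {k l : ℕ} {M : Type u₃} {C : Type u₄} {Z : Type u₅} {E : Type u₇}
  [Fintype M] [LinearOrder M] [Fintype C] [LinearOrder C] [Fintype Z] [LinearOrder Z]
  [Fintype E] [DecidableEq E]

theorem compJoint_mulVec_apply (v : Joint k l M C Z E → ℂ) (r : Reg k l M C Z E)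
    (D : Database k l M C Z) :
    (compJoint k l M C Z E).mulVec v (r, D) = (compDB k l M C Z).mulVec (fun D' => v (r, D')) D :=
  one_kronecker_mulVec_apply _ v r D

theorem sum_norm_sq_compJoint_mulVec (v : Joint k l M C Z E → ℂ) :
    ∑ s, ‖(compJoint k l M C Z E).mulVec v s‖ ^ 2 = ∑ s, ‖v s‖ ^ 2 := by
  simp_rw [Fintype.sum_prod_type (α₁ := Reg k l M C Z E), compJoint_mulVec_apply]
  refine Finset.sum_congr rfl fun r _ => ?_
  exact sum_norm_sq_mulVec (star_compDB_mul_self k l M C Z) _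

theorem oracle_mulVec_apply (v : Joint k l M C Z E → ℂ) (x : OracleInput k M C Z) (y : Hash l)
    (w : E × FProof k M C Z) (D : Database k l M C Z) :
    (oracle k l M C Z E).mulVec v ((x, y, w), D) =
      (oracleAt k l M C Z x).mulVec (fun q => v ((x, q.1, w), q.2)) (y, D) := by
  simp only [Matrix.mulVec, dotProduct, oracle, Matrix.of_apply]
  rw [Fintype.sum_prod_type, Fintype.sum_prod_type, Finset.sum_eq_single x]
  · rw [Fintype.sum_prod_type, Fintype.sum_prod_type]
    refine Finset.sum_congr rfl fun y' _ => ?_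
    rw [Finset.sum_eq_single w]
    · simp
    · intro w' _ h
      simp [h.symm]
    · simp
  · intro x' _ h
    simp [h.symm]
  · simp

theorem cnotAt_mulVec_apply (v : Hash l × Database k l M C Z → ℂ) (x : OracleInput k M C Z)
    (y : Hash l) (D : Database k l M C Z) :
    (cnotAt k l M C Z x).mulVec v (y, D) = v (y - (D x).getD 0, D) := by
  simp only [Matrix.mulVec, dotProduct, cnotAt, Matrix.of_apply]
  rw [Finset.sum_eq_single (y - (D x).getD 0, D)]
  · simp
  · rintro ⟨y', D'⟩ _ h
    rw [if_neg, zero_mul]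
    rintro ⟨h1, h2⟩
    simp only at h1 h2
    subst h1
    exact h (by rw [h2]; simp)
  · simp

/-- In the uncompressed picture the oracle shifts the query output register by the queried
value. -/
theorem compJoint_oracle_mulVec_apply (v : Joint k l M C Z E → ℂ) (x : OracleInput k M C Z)
    (y : Hash l) (w : E × FProof k M C Z) (D : Database k l M C Z) :
    (compJoint k l M C Z E).mulVec ((oracle k l M C Z E).mulVec v) ((x, y, w), D) =
      (compJoint k l M C Z E).mulVec v ((x, y - (D x).getD 0, w), D) := by
  rw [compJoint_mulVec_apply, compJoint_mulVec_apply]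
  simp_rw [oracle_mulVec_apply]
  rw [← one_kronecker_mulVec_apply (compDB k l M C Z)
      ((oracleAt k l M C Z x).mulVec fun q => v ((x, q.1, w), q.2)),
    Matrix.mulVec_mulVec, compDB_kronecker_mul_oracleAt, ← Matrix.mulVec_mulVec,
    cnotAt_mulVec_apply, one_kronecker_mulVec_apply]

theorem compJoint_mul_unitary (U : Matrix (Reg k l M C Z E) (Reg k l M C Z E) ℂ) :
    compJoint k l M C Z E * (U ⊗ₖ (1 : Matrix (Database k l M C Z) (Database k l M C Z) ℂ)) =
      (U ⊗ₖ (1 : Matrix (Database k l M C Z) (Database k l M C Z) ℂ)) * compJoint k l M C Z E := by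
  rw [compJoint, ← Matrix.mul_kronecker_mul, ← Matrix.mul_kronecker_mul, one_mul, mul_one,
    one_mul, mul_one]

/-- Whatever the prover does, measuring the oracle in the uncompressed picture gives a
uniformly random function. -/
theorem mass_stateAfter (A : Prover k l M C Z E) (n : ℕ) (D : Database k l M C Z) :
    ∑ r, ‖(compJoint k l M C Z E).mulVec (A.stateAfter n).ofLp (r, D)‖ ^ 2 =
      ‖compDB k l M C Z D (fun _ => none)‖ ^ 2 := by
  induction n with
  | zero =>
    have h1 : ∀ r, (compJoint k l M C Z E).mulVec (A.stateAfter 0).ofLp (r, D) =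
        compDB k l M C Z D (fun _ => none) * A.init r := by
      intro r
      rw [compJoint_mulVec_apply]
      simp [Prover.stateAfter, Matrix.mulVec, dotProduct]
    have h2 := A.norm_init
    rw [EuclideanSpace.norm_eq, Real.sqrt_eq_one] at h2
    simp_rw [h1, norm_mul, mul_pow, ← Finset.mul_sum, h2, mul_one]
  | succ n ih =>
    set v := (A.stateAfter n).ofLp with hv
    have h1 : (A.stateAfter (n + 1)).ofLp =
        ((A.unitary n : Matrix (Reg k l M C Z E) (Reg k l M C Z E) ℂ) ⊗ₖ
          (1 : Matrix (Database k l M C Z) (Database k l M C Z) ℂ)).mulVec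
          ((oracle k l M C Z E).mulVec v) := rfl
    rw [h1, Matrix.mulVec_mulVec, compJoint_mul_unitary, ← Matrix.mulVec_mulVec]
    simp_rw [kronecker_one_mulVec_apply]
    rw [sum_norm_sq_mulVec (Matrix.UnitaryGroup.star_mul_self (A.unitary n)), ← ih]
    simp_rw [Fintype.sum_prod_type (α₁ := OracleInput k M C Z),
      Fintype.sum_prod_type (α₁ := Hash l) (α₂ := E × FProof k M C Z),
      compJoint_oracle_mulVec_apply]
    refine Finset.sum_congr rfl fun x _ => ?_
    exact (Equiv.subRight ((D x).getD 0)).sum_comp fun y => ∑ w : E × FProof k M C Z,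
      ‖(compJoint k l M C Z E).mulVec v ((x, y, w), D)‖ ^ 2

end Game

/-! ### Projecting the successful states onto `𝓔_f` -/

theorem proj_mulVec {ι : Type*} [Fintype ι] [DecidableEq ι] (S : Set ι) (v : ι → ℂ) :
    (proj S).mulVec v = S.indicator v := by
  classical
  ext i
  rw [proj, Matrix.mulVec_diagonal]
  by_cases h : i ∈ S <;> simp [h]

/-- `exists_deg_one_sum` for a basis state: an unrecorded input contributes the constant `amp l`, so
at most one factor depends on the coordinates in `J`. -/
theorem exists_deg_one_prod_comp {ι : Type*} [Fintype ι] [DecidableEq ι] (l : ℕ) (J : Finset ι)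
    (D : ι → Option (Hash l)) (hD : ({x | x ∈ J ∧ D x ≠ none} : Set ι).Subsingleton)
    (r : {x // x ∉ J} → Hash l) :
    ∃ (a : ℂ) (b : {x // x ∈ J} → Hash l → ℂ), ∀ g : {x // x ∈ J} → Hash l,
      ∏ x, comp l (some (glue J g r x)) (D x) = a + ∑ x, b x (g x) := by
  set R := ∏ x ∈ Jᶜ, comp l (some (if h : x ∈ J then 0 else r ⟨x, h⟩)) (D x)
  have hR : ∀ g : {x // x ∈ J} → Hash l,
      ∏ x, comp l (some (glue J g r x)) (D x) =
        (∏ x : {x // x ∈ J}, comp l (some (g x)) (D x)) * R := by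
    intro g
    rw [← Finset.prod_mul_prod_compl J,
      prod_glue J g r fun x h => comp l (some h) (D x)]
    congr 1
    refine Finset.prod_congr rfl fun x hx => ?_
    have hx' := Finset.mem_compl.1 hx
    rw [glue_of_notMem g r hx', dif_neg hx']
  rcases Set.eq_empty_or_nonempty {x | x ∈ J ∧ D x ≠ none} with h | ⟨x₀, hx₀, hx₀'⟩
  · refine ⟨amp l ^ J.card * R, fun _ _ => 0, fun g => ?_⟩
    have h1 : ∀ x : {x // x ∈ J}, comp l (some (g x)) (D x) = amp l := by
      intro x
      have h2 : D x = none := by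
        by_contra h3
        have : (x : ι) ∈ ({x | x ∈ J ∧ D x ≠ none} : Set ι) := ⟨x.2, h3⟩
        rw [h] at this
        exact this
      rw [h2, comp_some_none]
    simp [hR, h1]
  · refine ⟨0, fun x h => if x = ⟨x₀, hx₀⟩ then
      comp l (some h) (D x₀) * amp l ^ (Finset.univ.erase (⟨x₀, hx₀⟩ : {x // x ∈ J})).card * R
      else 0, fun g => ?_⟩
    have h1 : ∀ x ∈ Finset.univ.erase (⟨x₀, hx₀⟩ : {x // x ∈ J}),
        comp l (some (g x)) (D x) = amp l := by
      intro x hx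
      have h2 : D x = none := by
        by_contra h3
        exact (Finset.mem_erase.1 hx).1 (Subtype.ext (hD ⟨x.2, h3⟩ ⟨hx₀, hx₀'⟩))
      rw [h2, comp_some_none]
    rw [hR, ← Finset.mul_prod_erase _ _ (Finset.mem_univ (⟨x₀, hx₀⟩ : {x // x ∈ J})),
      Finset.prod_congr rfl h1]
    simp

/-- Decompressing a state with at most one recorded input in the block `J` gives a function of
degree at most one in that block. -/
theorem exists_deg_one_sum {ι : Type*} [Fintype ι] [DecidableEq ι] (l : ℕ) (J : Finset ι)
    (w : (ι → Option (Hash l)) → ℂ)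
    (hw : ∀ D, w D ≠ 0 → ({x | x ∈ J ∧ D x ≠ none} : Set ι).Subsingleton)
    (r : {x // x ∉ J} → Hash l) :
    ∃ (a : ℂ) (b : {x // x ∈ J} → Hash l → ℂ), ∀ g : {x // x ∈ J} → Hash l,
      ∑ D, (∏ x, comp l (some (glue J g r x)) (D x)) * w D = a + ∑ x, b x (g x) := by
  have h1 : ∀ D, ∃ (a : ℂ) (b : {x // x ∈ J} → Hash l → ℂ), ∀ g : {x // x ∈ J} → Hash l,
      (∏ x, comp l (some (glue J g r x)) (D x)) * w D = a + ∑ x, b x (g x) := by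
    intro D
    by_cases h : w D = 0
    · exact ⟨0, fun _ _ => 0, by simp [h]⟩
    · obtain ⟨a, b, hab⟩ := exists_deg_one_prod_comp l J D (hw D h) r
      refine ⟨a * w D, fun x h => b x h * w D, fun g => ?_⟩
      rw [hab, add_mul, Finset.sum_mul]
  choose a b hab using h1
  refine ⟨∑ D, a D, fun x h => ∑ D, b D x h, fun g => ?_⟩
  simp_rw [hab, Finset.sum_add_distrib]
  rw [Finset.sum_comm]

theorem exists_eq_some_comp {ι α : Type*} {D : ι → Option α} (hD : ∀ x, D x ≠ none) :
    ∃ f : ι → α, (fun x => some (f x)) = D := by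
  choose f hf using fun x => Option.ne_none_iff_exists.1 (hD x)
  exact ⟨f, funext hf⟩

theorem some_comp_injective {ι α : Type*} :
    Function.Injective fun (f : ι → α) (x : ι) => some (f x) := fun f g h => by
  ext1 x
  simpa using congrFun h x

section Game

variable {X : Type u₁} {W : Type u₂} {R : X → W → Prop} {St : Type u₆}
  {k l : ℕ} {M : Type u₃} {C : Type u₄} {Z : Type u₅} {E : Type u₇}
  [Fintype M] [LinearOrder M] [Fintype C] [LinearOrder C] [Fintype Z] [LinearOrder Z]
  [Fintype E] [DecidableEq E]

theorem sum_some_comp_le (F : Database k l M C Z → ℝ) (hF : ∀ D, 0 ≤ F D) :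
    ∑ f : OracleInput k M C Z → Hash l, F (fun x => some (f x)) ≤ ∑ D, F D := by
  rw [← Finset.sum_image (s := Finset.univ) (g := fun f x => some (f x)) (f := F)
    (fun f _ g _ h => some_comp_injective h)]
  exact Finset.sum_le_sum_of_subset_of_nonneg (Finset.subset_univ _) fun D _ _ => hF D

theorem sum_eq_sum_some_comp (F : Database k l M C Z → ℝ)
    (hF : ∀ D x, D x = none → F D = 0) :
    ∑ D, F D = ∑ f : OracleInput k M C Z → Hash l, F (fun x => some (f x)) := by
  refine (Fintype.sum_of_injective _ some_comp_injective _ F ?_ fun _ => rfl).symm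
  intro D hD
  by_contra h
  exact hD (exists_eq_some_comp fun x hx => h (hF D x hx))

/-- The inputs of repetition `i` with commitment vector `a₀` and an accepted transcript. -/
def acceptedInputs (P : SigmaProtocol R M C Z St) (x : X) (a₀ : Fin k → M) (i : Fin k) :
    Finset (OracleInput k M C Z) :=
  Finset.univ.filter fun q =>
    q.1 = a₀ ∧ q.2.1 = i ∧ P.verify x (a₀ i) q.2.2.1 q.2.2.2 = true

omit [LinearOrder C] [LinearOrder Z] in
theorem mem_acceptedInputs (P : SigmaProtocol R M C Z St) (x : X) (a₀ : Fin k → M) (i : Fin k)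
    (q : OracleInput k M C Z) : q ∈ acceptedInputs P x a₀ i ↔
      q.1 = a₀ ∧ q.2.1 = i ∧ P.verify x (a₀ i) q.2.2.1 q.2.2.2 = true := by
  simp [acceptedInputs]

omit [LinearOrder C] [LinearOrder Z] in
theorem disjoint_acceptedInputs (P : SigmaProtocol R M C Z St) (x : X) (a₀ : Fin k → M)
    (i j : Fin k) (hij : i ≠ j) :
    Disjoint (acceptedInputs P x a₀ i) (acceptedInputs P x a₀ j) := by
  refine Finset.disjoint_left.2 fun q hi hj => hij ?_
  rw [mem_acceptedInputs] at hi hj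
  exact hi.2.1.symm.trans hj.2.1

omit [LinearOrder C] in
theorem card_acceptedInputs_le {P : SigmaProtocol R M C Z St} (hP : P.UniqueResponses) (x : X)
    (a₀ : Fin k → M) (i : Fin k) : (acceptedInputs P x a₀ i).card ≤ Fintype.card C := by
  refine Finset.card_le_card_of_injOn (fun q => q.2.2.1) (fun _ _ => Finset.mem_univ _) ?_
  rintro ⟨a, i₁, c, z⟩ h ⟨a', i₁', c', z'⟩ h' hc
  rw [Finset.mem_coe, mem_acceptedInputs] at h h'
  obtain ⟨rfl, rfl, hv⟩ := h
  obtain ⟨rfl, rfl, hv'⟩ := h'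
  simp only at hc hv hv'
  subst hc
  by_cases hz : z = z'
  · rw [hz]
  · rcases hP x _ c z z' hz with h | h
    · rw [hv] at h; cases h
    · rw [hv'] at h; cases h

/-- The databases spanning the range of `𝓔_f`: at most one recorded accepted input for each
repetition. -/
def OneRecorded (P : SigmaProtocol R M C Z St) (x : X) (a₀ : Fin k → M)
    (D : Database k l M C Z) : Prop :=
  ∀ i, {cz : C × Z | P.verify x (a₀ i) cz.1 cz.2 = true ∧
    D (a₀, i, cz.1, cz.2) ≠ none}.Subsingleton

omit [LinearOrder C] [LinearOrder Z] in
theorem OneRecorded.subsingleton {P : SigmaProtocol R M C Z St} {x : X} {a₀ : Fin k → M}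
    {D : Database k l M C Z} (h : OneRecorded P x a₀ D) (i : Fin k) :
    ({q | q ∈ acceptedInputs P x a₀ i ∧ D q ≠ none} :
      Set (OracleInput k M C Z)).Subsingleton := by
  rintro ⟨a, j, c, z⟩ ⟨hq, hD⟩ ⟨a', j', c', z'⟩ ⟨hq', hD'⟩
  rw [mem_acceptedInputs] at hq hq'
  obtain ⟨rfl, rfl, hv⟩ := hq
  obtain ⟨rfl, rfl, hv'⟩ := hq'
  have := h _ (show (c, z) ∈ _ from ⟨hv, hD⟩) (show (c', z') ∈ _ from ⟨hv', hD'⟩)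
  rw [Prod.mk.injEq] at this
  rw [this.1, this.2]

/-- The databases with few zero hashes among the accepted inputs. An unrecorded input counts as
hashed to `0`; this convention plays no role, as only databases without `⊥` occur. -/
def FewHits (P : SigmaProtocol R M C Z St) (x : X) (a₀ : Fin k → M)
    (D : Database k l M C Z) : Prop :=
  (hits (acceptedInputs P x a₀) 0 fun q => (D q).getD 0 : ℝ) ≤
    hitBound (Hash l) (acceptedInputs P x a₀)

open Classical in
/-- For a fixed accepted proof in the output register: projecting a state on databases with few
hits onto `𝓔_f` leaves little. -/
theorem sum_norm_sq_oneRecorded_le {P : SigmaProtocol R M C Z St} (x : X) (a₀ : Fin k → M)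
    (π : FProof k M C Z) {s : ℝ} (hs : 0 < s) (hs1 : s ≤ 1 / 8) (hl : 14 ≤ l)
    (hn : ∀ i, s * (acceptedInputs P x a₀ i).card ≤ (2 : ℝ) ^ l / 8)
    (y : Database k l M C Z → ℂ)
    (hy : ∀ D, y D ≠ 0 → (∀ q, D q ≠ none) ∧ Accepts P x a₀ D π ∧ FewHits P x a₀ D) :
    ∑ D, (if OneRecorded P x a₀ D then ‖(compDB k l M C Z).mulVec y D‖ ^ 2 else 0) ≤
      Real.exp (-(s * k / 4)) * ∑ D, ‖y D‖ ^ 2 := by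
  by_cases hy0 : y = 0
  · simp [hy0]
  obtain ⟨D₀, hD₀⟩ := Function.ne_iff.1 hy0
  obtain ⟨hπ, hacc⟩ := (hy D₀ hD₀).2.1
  set J := acceptedInputs P x a₀ with hJ
  set t : Fin k → OracleInput k M C Z := fun i => (π.1, i, π.2.1 i, π.2.2 i) with htdef
  have ht : ∀ i, t i ∈ J i := fun i => by
    rw [hJ, mem_acceptedInputs]
    refine ⟨hπ, rfl, ?_⟩
    rw [← hπ]
    exact (hacc i).2
  set A := compDB k l M C Z with hA
  set w : Database k l M C Z → ℂ := fun D => if OneRecorded P x a₀ D then A.mulVec y D else 0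
    with hw
  have hcard : (Fintype.card (Hash l) : ℝ) = 2 ^ l := by rw [card_hash]; push_cast; rfl
  -- decompressing `w` gives a function of degree one in each block
  have hfew := sum_few_hits_le J (disjoint_acceptedInputs P x a₀) (0 : Hash l) t ht
    (fun f => A.mulVec w fun q => some (f q))
    (fun i r => exists_deg_one_sum l (J i) w (fun D hD => by
      have : OneRecorded P x a₀ D := by
        by_contra h
        exact hD (by simp [hw, h])
      exact this.subsingleton i) r) hs hs1
    (by rw [hcard]; exact pow_le_pow_right₀ (by norm_num) hl) (by rw [hcard]; exact hn)
  rw [Fintype.card_fin] at hfew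
  set η := Real.exp (-(s * k / 4))
  set W := ∑ D, ‖w D‖ ^ 2 with hWdef
  have hW0 : 0 ≤ W := Finset.sum_nonneg fun D _ => sq_nonneg _
  set Y := ∑ D, ‖y D‖ ^ 2
  have hY0 : 0 ≤ Y := Finset.sum_nonneg fun D _ => sq_nonneg _
  have hgoal : ∑ D, (if OneRecorded P x a₀ D then ‖A.mulVec y D‖ ^ 2 else 0) = W := by
    refine Finset.sum_congr rfl fun D _ => ?_
    simp only [hw]
    split_ifs <;> simp
  rw [hgoal]
  have hAA : star A = A := by
    have h1 := star_compDB_mul_self k l M C Z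
    calc star A = star A * (A * A) := by rw [hA, compDB_mul_compDB, mul_one]
      _ = A := by rw [← mul_assoc, h1, one_mul]
  set u : Database k l M C Z → ℝ := fun D => if y D = 0 then 0 else ‖A.mulVec w D‖ with hu
  -- `‖w‖² = ⟨w, A y⟩ = ⟨A w, y⟩`
  have h1 : (W : ℂ) = ∑ D, star (A.mulVec w D) * y D := by
    have h2 : star w ⬝ᵥ A.mulVec y = star (A.mulVec w) ⬝ᵥ y := by
      rw [Matrix.star_mulVec, ← Matrix.star_eq_conjTranspose, hAA, Matrix.dotProduct_mulVec]
    have h3 : (W : ℂ) = star w ⬝ᵥ A.mulVec y := by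
      rw [hWdef]
      push_cast
      refine Finset.sum_congr rfl fun D _ => ?_
      simp only [hw, Pi.star_apply]
      split_ifs
      · simp [Complex.conj_mul']
      · simp
    rw [h3, h2]
    rfl
  have h4 : W ≤ ∑ D, u D * ‖y D‖ := by
    have h5 : W = ‖∑ D, star (A.mulVec w D) * y D‖ := by
      rw [← h1, Complex.norm_real, Real.norm_of_nonneg hW0]
    rw [h5]
    refine (norm_sum_le _ _).trans (Finset.sum_le_sum fun D _ => ?_)
    rw [norm_mul, norm_star]
    simp only [hu]
    split_ifs with h
    · simp [h]
    · exact le_rfl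
  have h6 : ∑ D, u D ^ 2 ≤ η * W := by
    rw [sum_eq_sum_some_comp (fun D => u D ^ 2) (by
      intro D q hq
      have : y D = 0 := by
        by_contra h
        exact (hy D h).1 q hq
      simp [hu, this])]
    refine (Finset.sum_le_sum fun f _ => ?_).trans (hfew.trans ?_)
    · by_cases h : y (fun q => some (f q)) = 0
      · rw [show u (fun q => some (f q)) = 0 by simp [hu, h], zero_pow two_ne_zero]
        split_ifs
        · exact sq_nonneg _
        · exact le_rfl
      · obtain ⟨-, ha, hf⟩ := hy _ h
        rw [if_pos]
        · simp [hu, h]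
        · refine ⟨by simpa [FewHits] using hf, fun i => ?_⟩
          simpa using (ha.2 i).1
    · gcongr
      calc _ ≤ ∑ D, ‖A.mulVec w D‖ ^ 2 :=
            sum_some_comp_le (fun D => ‖A.mulVec w D‖ ^ 2) fun D => sq_nonneg _
        _ = W := sum_norm_sq_mulVec (star_compDB_mul_self k l M C Z) w
  have h7 : W ^ 2 ≤ (η * W) * Y := by
    calc W ^ 2 ≤ (∑ D, u D * ‖y D‖) ^ 2 := by gcongr
      _ ≤ (∑ D, u D ^ 2) * ∑ D, ‖y D‖ ^ 2 := Finset.sum_mul_sq_le_sq_mul_sq _ _ _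
      _ ≤ _ := by gcongr
  have hη : 0 < η := Real.exp_pos _
  rcases hW0.eq_or_lt with h | h
  · rw [← h]; positivity
  · have : W * W ≤ W * (η * Y) := by nlinarith
    exact le_of_mul_le_mul_left this h

omit [LinearOrder M] [LinearOrder C] [LinearOrder Z] in
theorem norm_sq_compDB_some_none (f : OracleInput k M C Z → Hash l) :
    ‖compDB k l M C Z (fun q => some (f q)) (fun _ => none)‖ ^ 2 =
      (1 / 2 ^ l) ^ Fintype.card (OracleInput k M C Z) := by
  simp only [compDB, Matrix.of_apply, comp_some_none, Finset.prod_const, Finset.card_univ]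
  rw [norm_pow, ← pow_mul, mul_comm, pow_mul, norm_amp_sq]

omit [LinearOrder M] [LinearOrder C] [LinearOrder Z] in
theorem compDB_none_eq_zero (D : Database k l M C Z) (q : OracleInput k M C Z)
    (hq : D q = none) : compDB k l M C Z D (fun _ => none) = 0 := by
  simp only [compDB, Matrix.of_apply]
  exact Finset.prod_eq_zero (Finset.mem_univ q) (by rw [hq, comp_none_none])

theorem sum_norm_sq_finalState_apply (A : Prover k l M C Z E) (D : Database k l M C Z) :
    ∑ r, ‖A.finalState (r, D)‖ ^ 2 = ‖compDB k l M C Z D (fun _ => none)‖ ^ 2 :=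
  mass_stateAfter A A.queries D

theorem finalState_eq_zero (A : Prover k l M C Z E) (r : Reg k l M C Z E)
    (D : Database k l M C Z) (q : OracleInput k M C Z) (hq : D q = none) :
    A.finalState (r, D) = 0 := by
  have h := sum_norm_sq_finalState_apply A D
  rw [compDB_none_eq_zero D q hq, norm_zero, zero_pow two_ne_zero,
    Finset.sum_eq_zero_iff_of_nonneg fun r _ => sq_nonneg _] at h
  simpa using h r (Finset.mem_univ r)

theorem sum_norm_sq_finalState (A : Prover k l M C Z E) : ∑ s, ‖A.finalState s‖ ^ 2 = 1 := by
  rw [Fintype.sum_prod_type_right]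
  simp_rw [sum_norm_sq_finalState_apply]
  rw [sum_eq_sum_some_comp (fun D => ‖compDB k l M C Z D (fun _ => none)‖ ^ 2)
    fun D q hq => by simp [compDB_none_eq_zero D q hq]]
  simp_rw [norm_sq_compDB_some_none]
  rw [Finset.sum_const, Finset.card_univ, Fintype.card_fun, card_hash, nsmul_eq_mul]
  push_cast
  rw [← mul_pow, mul_one_div_cancel (by positivity), one_pow]

open Classical in
/-- The Chernoff bound `card_many_hits_le` for the final state, whose oracle register is distributed
like a uniformly random function. -/
theorem sum_norm_sq_many_hits_le {P : SigmaProtocol R M C Z St} (x : X) (a₀ : Fin k → M)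
    {s : ℝ} (hs : 0 < s) (hs1 : s ≤ 1 / 8) (hl : 14 ≤ l)
    (hn : ∀ i, s * (acceptedInputs P x a₀ i).card ≤ (2 : ℝ) ^ l / 8) (A : Prover k l M C Z E) :
    ∑ s, (if FewHits P x a₀ s.2 then 0 else ‖A.finalState s‖ ^ 2) ≤
      Real.exp (-(s * k / 4)) := by
  have hcard : (Fintype.card (Hash l) : ℝ) = 2 ^ l := by rw [card_hash]; push_cast; rfl
  have h1 := card_many_hits_le (acceptedInputs P x a₀) (disjoint_acceptedInputs P x a₀)
    (0 : Hash l) hs hs1 (by rw [hcard]; exact pow_le_pow_right₀ (by norm_num) hl)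
    (by rw [hcard]; exact hn)
  rw [Fintype.card_fin, hcard] at h1
  set n := Fintype.card (OracleInput k M C Z)
  rw [Fintype.sum_prod_type_right]
  have h2 : ∀ D : Database k l M C Z, ∑ r : Reg k l M C Z E,
      (if FewHits P x a₀ D then 0 else ‖A.finalState (r, D)‖ ^ 2) =
      if FewHits P x a₀ D then 0 else ‖compDB k l M C Z D (fun _ => none)‖ ^ 2 := by
    intro D
    split_ifs
    · simp
    · exact sum_norm_sq_finalState_apply A D
  simp_rw [h2]
  rw [sum_eq_sum_some_comp _ fun D q hq => by simp [compDB_none_eq_zero D q hq]]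
  simp_rw [norm_sq_compDB_some_none]
  calc _ = (1 / 2 ^ l) ^ n * ∑ f : OracleInput k M C Z → Hash l,
        (if (hits (acceptedInputs P x a₀) 0 f : ℝ) ≤ hitBound (Hash l) (acceptedInputs P x a₀)
          then (0 : ℝ) else 1) := by
        rw [Finset.mul_sum]
        refine Finset.sum_congr rfl fun f _ => ?_
        simp only [FewHits, Option.getD_some, mul_ite, mul_zero, mul_one]
        rfl
    _ ≤ (1 / 2 ^ l) ^ n * (Real.exp (-(s * k / 4)) * (2 ^ l) ^ n) := by gcongr
    _ = Real.exp (-(s * k / 4)) * (1 / 2 ^ l * 2 ^ l) ^ n := by rw [mul_pow]; ring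
    _ = _ := by rw [one_div_mul_cancel (by positivity), one_pow, mul_one]

open Classical in
/-- The probability of success together with a database in the range of `𝓔_f`. The state after
verification is split according to the number of zero hashes: many of them are improbable, and
few of them are nearly incompatible with `𝓔_f`. The factor `4` comes from
`‖p + q‖² ≤ 2 ‖p‖² + 2 ‖q‖²`. -/
theorem sum_norm_sq_fail_le {P : SigmaProtocol R M C Z St} (x : X) (a₀ : Fin k → M)
    {s : ℝ} (hs : 0 < s) (hs1 : s ≤ 1 / 8) (hl : 14 ≤ l)
    (hn : ∀ i, s * (acceptedInputs P x a₀ i).card ≤ (2 : ℝ) ^ l / 8) (A : Prover k l M C Z E) :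
    ∑ s, (if OneRecorded P x a₀ s.2 then ‖(compJoint k l M C Z E).mulVec
      ((successProj P x a₀).mulVec A.finalState.ofLp) s‖ ^ 2 else 0) ≤
      4 * Real.exp (-(s * k / 4)) := by
  set v := (successProj P x a₀).mulVec A.finalState.ofLp with hv
  set η := Real.exp (-(s * k / 4)) with hη
  have hη0 : 0 < η := Real.exp_pos _
  have hvle : ∀ s, ‖v s‖ ≤ ‖A.finalState s‖ := by
    intro s
    rw [hv, successProj, proj_mulVec]
    exact norm_indicator_le_norm_self _ _
  have hvacc : ∀ s, v s ≠ 0 → Accepts P x a₀ s.2 s.1.2.2.2 := by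
    intro s h
    rw [hv, successProj, proj_mulVec] at h
    have h' : s ∈ {s : Joint k l M C Z E | Accepts P x a₀ s.2 s.1.2.2.2} :=
      Set.mem_of_indicator_ne_zero h
    exact h'
  set v₁ : Joint k l M C Z E → ℂ := fun s => if FewHits P x a₀ s.2 then v s else 0 with hv₁
  set v₂ : Joint k l M C Z E → ℂ := fun s => if FewHits P x a₀ s.2 then 0 else v s with hv₂
  have hsplit : v = v₁ + v₂ := by
    ext s
    simp only [hv₁, hv₂, Pi.add_apply]
    split_ifs <;> simp
  have h1 : ∑ s, (if OneRecorded P x a₀ s.2 then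
      ‖(compJoint k l M C Z E).mulVec v₁ s‖ ^ 2 else 0) ≤ η := by
    rw [Fintype.sum_prod_type (α₁ := Reg k l M C Z E)]
    simp_rw [compJoint_mulVec_apply]
    calc _ ≤ ∑ r : Reg k l M C Z E, η * ∑ D, ‖v₁ (r, D)‖ ^ 2 := by
          refine Finset.sum_le_sum fun r _ => ?_
          refine sum_norm_sq_oneRecorded_le x a₀ r.2.2.2 hs hs1 hl hn (fun D => v₁ (r, D)) ?_
          intro D hD
          simp only [hv₁] at hD
          split_ifs at hD with hf
          · refine ⟨fun q hq => hD ?_, hvacc (r, D) hD, hf⟩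
            have := hvle (r, D)
            rw [finalState_eq_zero A r D q hq, norm_zero] at this
            exact norm_le_zero_iff.1 this
          · exact absurd rfl hD
      _ ≤ ∑ r : Reg k l M C Z E, η * ∑ D, ‖A.finalState (r, D)‖ ^ 2 := by
          gcongr with r _ D _
          simp only [hv₁]
          split_ifs
          · exact hvle _
          · simp
      _ = η := by
          rw [← Finset.mul_sum, ← Fintype.sum_prod_type fun s => ‖A.finalState s‖ ^ 2,
            sum_norm_sq_finalState, mul_one]
  have h2 : ∑ s, (if OneRecorded P x a₀ s.2 then
      ‖(compJoint k l M C Z E).mulVec v₂ s‖ ^ 2 else 0) ≤ η := by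
    calc _ ≤ ∑ s, ‖(compJoint k l M C Z E).mulVec v₂ s‖ ^ 2 := by
          refine Finset.sum_le_sum fun s _ => ?_
          split_ifs
          · exact le_rfl
          · positivity
      _ = ∑ s, ‖v₂ s‖ ^ 2 := sum_norm_sq_compJoint_mulVec v₂
      _ ≤ ∑ s, (if FewHits P x a₀ s.2 then 0 else ‖A.finalState s‖ ^ 2) := by
          refine Finset.sum_le_sum fun s _ => ?_
          simp only [hv₂]
          split_ifs
          · simp
          · exact pow_le_pow_left₀ (norm_nonneg _) (hvle s) 2
      _ ≤ η := sum_norm_sq_many_hits_le x a₀ hs hs1 hl hn A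
  calc _ ≤ ∑ s, (2 * (if OneRecorded P x a₀ s.2 then
          ‖(compJoint k l M C Z E).mulVec v₁ s‖ ^ 2 else 0) +
        2 * (if OneRecorded P x a₀ s.2 then
          ‖(compJoint k l M C Z E).mulVec v₂ s‖ ^ 2 else 0)) := by
        refine Finset.sum_le_sum fun s _ => ?_
        rw [hsplit, Matrix.mulVec_add, Pi.add_apply]
        split_ifs
        · set p := (compJoint k l M C Z E).mulVec v₁ s
          set q := (compJoint k l M C Z E).mulVec v₂ s
          have := norm_add_le p q
          nlinarith [sq_nonneg (‖p‖ - ‖q‖), norm_nonneg (p + q)]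
        · simp
    _ ≤ _ := by
        rw [Finset.sum_add_distrib, ← Finset.mul_sum, ← Finset.mul_sum]
        linarith

end Game

/-! ### The extractor -/

section Game

variable {X : Type u₁} {W : Type u₂} {R : X → W → Prop} {St : Type u₆}
  {k l : ℕ} {M : Type u₃} {C : Type u₄} {Z : Type u₅} {E : Type u₇}
  [Fintype M] [LinearOrder M] [Fintype C] [LinearOrder C] [Fintype Z] [LinearOrder Z]
  [Fintype E] [DecidableEq E]

/-- The extractor aborts. -/
theorem extractFailProb_eq_one {P : SigmaProtocol R M C Z St} {x : X} {S : Set (Fin k → M)}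
    {D : Database k l M C Z} (h : ¬ (goodPairs P x S D).Nonempty) :
    extractFailProb P x S D = 1 := by
  have h1 : extractor P x S D = PMF.pure none := by
    simp [extractor, firstPair, h]
  rw [extractFailProb, h1, PMF.toOuterMeasure_pure_apply, if_pos (by simp), ENNReal.toReal_one]

/-- By special soundness; two accepted transcripts with the same commitment have different
challenges because responses are unique. -/
theorem extractFailProb_eq_zero {P : SigmaProtocol R M C Z St} (hP : P.UniqueResponses) {x : X}
    {S : Set (Fin k → M)} {D : Database k l M C Z} (h : (goodPairs P x S D).Nonempty) :
    extractFailProb P x S D = 0 := by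
  obtain ⟨p, hp, hmem⟩ : ∃ p, firstPair P x S D = some p ∧ p ∈ goodPairs P x S D := by
    rw [firstPair, dif_pos h]
    exact ⟨_, rfl, (Set.exists_min_image (goodPairs P x S D)
      (fun p => toLex (lexKey p.1, lexKey p.2)) (Set.toFinite _) h).choose_spec.1⟩
  obtain ⟨a, i, c, c', z, z', rfl, -, -, -, hne, hv, hv'⟩ := hmem
  have hc : c ≠ c' := by
    rintro rfl
    have hz : z ≠ z' := fun hz => hne (by rw [hz])
    rcases hP x (a i) c z z' hz with h | h
    · rw [hv] at h; cases h
    · rw [hv'] at h; cases h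
  have h1 : extractor P x S D = (P.ext x (a i) c z c' z').map some := by
    simp [extractor, hp]
  rw [extractFailProb, h1, (PMF.toOuterMeasure_apply_eq_zero_iff _ _).2, ENNReal.toReal_zero]
  rw [Set.disjoint_left, PMF.support_map]
  rintro _ ⟨w, hw, rfl⟩ hbad
  exact hbad w rfl (P.specialSoundness x (a i) c z c' z' hc hv hv' w hw)

omit [Fintype M] [LinearOrder M] [Fintype C] [LinearOrder C] [Fintype Z] [LinearOrder Z] in
theorem goodPairs_nonempty_of_not_oneRecorded {P : SigmaProtocol R M C Z St} {x : X}
    {a₀ : Fin k → M} {S : Set (Fin k → M)} (ha : a₀ ∈ S) {D : Database k l M C Z}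
    (h : ¬ OneRecorded P x a₀ D) : (goodPairs P x S D).Nonempty := by
  simp only [OneRecorded, not_forall, Set.not_subsingleton_iff] at h
  obtain ⟨i, ⟨c, z⟩, ⟨hv, hD⟩, ⟨c', z'⟩, ⟨hv', hD'⟩, hne⟩ := h
  exact ⟨_, a₀, i, c, c', z, z', rfl, ha, hD, hD', hne, hv, hv'⟩

omit [Fintype M] [LinearOrder M] [Fintype C] [LinearOrder C] [Fintype Z] [LinearOrder Z] in
theorem not_goodPairs_nonempty_of_oneRecorded {P : SigmaProtocol R M C Z St} {x : X}
    {a₀ : Fin k → M} {D : Database k l M C Z} (h : OneRecorded P x a₀ D) :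
    ¬ (goodPairs P x {a₀} D).Nonempty := by
  rintro ⟨_, a, i, c, c', z, z', rfl, ha, hD, hD', hne, hv, hv'⟩
  rw [Set.mem_singleton_iff] at ha
  subst ha
  exact hne (h i (show (c, z) ∈ _ from ⟨hv, hD⟩) (show (c', z') ∈ _ from ⟨hv', hD'⟩))

open Classical in
theorem extractFailProb_le {P : SigmaProtocol R M C Z St} (hP : P.UniqueResponses) {x : X}
    {a₀ : Fin k → M} {S : Set (Fin k → M)} (ha : a₀ ∈ S) (D : Database k l M C Z) :
    extractFailProb P x S D ≤ if OneRecorded P x a₀ D then 1 else 0 := by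
  by_cases hg : (goodPairs P x S D).Nonempty
  · rw [extractFailProb_eq_zero hP hg]
    split_ifs <;> norm_num
  · rw [extractFailProb_eq_one hg, if_pos]
    by_contra h
    exact hg (goodPairs_nonempty_of_not_oneRecorded ha h)

open Classical in
theorem extractFailProb_singleton {P : SigmaProtocol R M C Z St} (hP : P.UniqueResponses) {x : X}
    {a₀ : Fin k → M} (D : Database k l M C Z) :
    extractFailProb P x {a₀} D = if OneRecorded P x a₀ D then 1 else 0 := by
  split_ifs with h
  · exact extractFailProb_eq_one (not_goodPairs_nonempty_of_oneRecorded h)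
  · exact extractFailProb_eq_zero hP
      (goodPairs_nonempty_of_not_oneRecorded (Set.mem_singleton a₀) h)

open Classical in
theorem norm_sq_failProjComp (P : SigmaProtocol R M C Z St) (x : X) (a₀ : Fin k → M)
    (A : Prover k l M C Z E) :
    ‖Matrix.toEuclideanLin (failProjComp P x a₀)
      (Matrix.toEuclideanLin (successProj P x a₀) A.finalState)‖ ^ 2 =
    ∑ s, (if OneRecorded P x a₀ s.2 then ‖(compJoint k l M C Z E).mulVec
      ((successProj P x a₀).mulVec A.finalState.ofLp) s‖ ^ 2 else 0) := by
  rw [EuclideanSpace.norm_sq_eq]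
  set v := (successProj P x a₀).mulVec A.finalState.ofLp with hv
  have h1 : (Matrix.toEuclideanLin (failProjComp P x a₀)
      (Matrix.toEuclideanLin (successProj P x a₀) A.finalState)).ofLp =
      (compJoint k l M C Z E).mulVec
        ((failProj P x a₀).mulVec ((compJoint k l M C Z E).mulVec v)) := by
    rw [Matrix.mulVec_mulVec, Matrix.mulVec_mulVec]
    rfl
  rw [h1, sum_norm_sq_compJoint_mulVec]
  refine Finset.sum_congr rfl fun s _ => ?_
  have h2 : failProj P x a₀ = proj {s : Joint k l M C Z E | OneRecorded P x a₀ s.2} := rfl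
  rw [h2, proj_mulVec]
  by_cases h : OneRecorded P x a₀ s.2
  · rw [if_pos h, Set.indicator_of_mem
      (show s ∈ {s : Joint k l M C Z E | OneRecorded P x a₀ s.2} from h)]
  · rw [if_neg h, Set.indicator_of_notMem
      (show s ∉ {s : Joint k l M C Z E | OneRecorded P x a₀ s.2} from h)]
    simp

open Classical in
theorem winProb_singleton {P : SigmaProtocol R M C Z St} (hP : P.UniqueResponses) (x : X)
    (a₀ : Fin k → M) (A : Prover k l M C Z E) :
    winProb P x a₀ {a₀} A = ‖Matrix.toEuclideanLin (failProjComp P x a₀)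
      (Matrix.toEuclideanLin (successProj P x a₀) A.finalState)‖ ^ 2 := by
  rw [norm_sq_failProjComp, winProb]
  refine Finset.sum_congr rfl fun s _ => ?_
  rw [extractFailProb_singleton hP, mul_ite, mul_one, mul_zero]
  rfl

open Classical in
theorem winProb_le {P : SigmaProtocol R M C Z St} (hP : P.UniqueResponses) (x : X)
    (a₀ : Fin k → M) {S : Set (Fin k → M)} (ha : a₀ ∈ S) (A : Prover k l M C Z E) :
    winProb P x a₀ S A ≤ ‖Matrix.toEuclideanLin (failProjComp P x a₀)
      (Matrix.toEuclideanLin (successProj P x a₀) A.finalState)‖ ^ 2 := by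
  rw [← winProb_singleton hP, winProb, winProb]
  refine Finset.sum_le_sum fun s _ => ?_
  rw [extractFailProb_singleton hP]
  gcongr
  exact extractFailProb_le hP ha s.2

theorem norm_sq_failProjComp_le_one (P : SigmaProtocol R M C Z St) (x : X) (a₀ : Fin k → M)
    (A : Prover k l M C Z E) :
    ‖Matrix.toEuclideanLin (failProjComp P x a₀)
      (Matrix.toEuclideanLin (successProj P x a₀) A.finalState)‖ ^ 2 ≤ 1 := by
  classical
  rw [norm_sq_failProjComp]
  calc _ ≤ ∑ s, ‖(compJoint k l M C Z E).mulVec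
        ((successProj P x a₀).mulVec A.finalState.ofLp) s‖ ^ 2 := by
        refine Finset.sum_le_sum fun s _ => ?_
        split_ifs
        · exact le_rfl
        · positivity
    _ = ∑ s, ‖(successProj P x a₀).mulVec A.finalState.ofLp s‖ ^ 2 :=
        sum_norm_sq_compJoint_mulVec _
    _ ≤ ∑ s, ‖A.finalState s‖ ^ 2 := by
        refine Finset.sum_le_sum fun s _ => ?_
        rw [successProj, proj_mulVec]
        exact pow_le_pow_left₀ (norm_nonneg _) (norm_indicator_le_norm_self _ _) 2
    _ = 1 := sum_norm_sq_finalState A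

end Game

/-! ### The error bound -/

/-- The error bound: `epsBound`, cut off at `1/2`, where `ε / (1 - ε)` reaches the trivial bound
`1` on a probability. -/
def errBound (c : ℝ) (k l : ℕ) : ℝ := min (epsBound c k l) (1 / 2)

theorem epsBound_nonneg (c : ℝ) (k l : ℕ) : 0 ≤ epsBound c k l := by
  unfold epsBound
  positivity

theorem errBound_nonneg (c : ℝ) (k l : ℕ) : 0 ≤ errBound c k l :=
  le_min (epsBound_nonneg c k l) (by norm_num)

theorem errBound_le_half (c : ℝ) (k l : ℕ) : errBound c k l ≤ 1 / 2 := min_le_right _ _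

theorem Admissible.one_le_mul_logb {c : ℝ} {k l : ℕ} (h : Admissible c k l) :
    0 < (k : ℝ) ∧ 1 ≤ c * Real.logb 2 k := by
  obtain ⟨hc, hk, -, -⟩ := h
  have hk0 : (0 : ℝ) < k := lt_of_lt_of_le (by positivity) hk
  refine ⟨hk0, ?_⟩
  have h1 := (Real.le_logb_iff_rpow_le (by norm_num) hk0).2 hk
  rwa [div_le_iff₀' hc] at h1

/-- The bound on the failure probability. When `epsBound` is at least `1 / 2` it is the trivial one;
otherwise `sum_norm_sq_fail_le` is applied with `s = 1 / (8 c log k)`. -/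
theorem norm_sq_failProjComp_le {X : Type u₁} {W : Type u₂} {R : X → W → Prop} {St : Type u₆}
    {k l : ℕ} {M : Type u₃} {C : Type u₄} {Z : Type u₅} {E : Type u₇}
    [Fintype M] [LinearOrder M] [Fintype C] [LinearOrder C] [Fintype Z] [LinearOrder Z]
    [Fintype E] [DecidableEq E] {c : ℝ} (h : Admissible c k l) {P : SigmaProtocol R M C Z St}
    (hP : P.UniqueResponses) (hC : (Fintype.card C : ℝ) = c * 2 ^ l * Real.logb 2 k)
    (x : X) (a₀ : Fin k → M) (A : Prover k l M C Z E) :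
    ‖Matrix.toEuclideanLin (failProjComp P x a₀)
      (Matrix.toEuclideanLin (successProj P x a₀) A.finalState)‖ ^ 2 ≤
      errBound c k l / (1 - errBound c k l) := by
  classical
  rcases le_or_gt (1 / 2) (epsBound c k l) with hε | hε
  · rw [errBound, min_eq_right hε]
    exact (norm_sq_failProjComp_le_one P x a₀ A).trans (by norm_num)
  obtain ⟨hk0, hlam⟩ := h.one_le_mul_logb
  set lam := c * Real.logb 2 k with hlamdef
  have hl : 14 ≤ l := h.2.2.2
  have hlam0 : 0 < lam := by linarith
  have h1 := sum_norm_sq_fail_le (P := P) x a₀ (s := 1 / (8 * lam)) (by positivity)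
    (by gcongr; linarith) hl (by
      intro i
      have : ((acceptedInputs P x a₀ i).card : ℝ) ≤ lam * 2 ^ l := by
        calc _ ≤ (Fintype.card C : ℝ) := by exact_mod_cast card_acceptedInputs_le hP x a₀ i
          _ = _ := by rw [hC, hlamdef]; ring
      calc _ ≤ 1 / (8 * lam) * (lam * 2 ^ l) := by gcongr
        _ = _ := by field_simp) A
  rw [norm_sq_failProjComp]
  refine h1.trans ?_
  set y := Real.exp (-((k : ℝ) / (128 * c * 2 ^ l * Real.logb 2 k))) with hy
  have hy0 : 0 < y := Real.exp_pos _
  have hy1 : 3 * y ≤ epsBound c k l := by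
    rw [epsBound, hy]
    have := Real.exp_pos (-((k : ℝ) / (8 * 2 ^ l)))
    linarith
  have h2l : (2 : ℝ) ≤ 2 ^ l := by
    calc (2 : ℝ) = 2 ^ 1 := by norm_num
      _ ≤ 2 ^ l := pow_le_pow_right₀ (by norm_num) (by omega)
  -- the exponent gained is larger than the one required by a factor of at least two
  have h2 : Real.exp (-(1 / (8 * lam) * k / 4)) ≤ y ^ 2 := by
    rw [hy, ← Real.exp_nat_mul]
    refine Real.exp_le_exp.2 ?_
    have h3 : (128 * c * 2 ^ l * Real.logb 2 k) = 128 * lam * 2 ^ l := by rw [hlamdef]; ring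
    rw [h3]
    have h4 : (k : ℝ) / (128 * lam * 2 ^ l) ≤ k / (128 * lam * 2) := by gcongr
    have h5 : 1 / (8 * lam) * k / 4 = 8 * ((k : ℝ) / (128 * lam * 2)) := by field_simp; norm_num
    have h6 : 0 ≤ (k : ℝ) / (128 * lam * 2) := by positivity
    push_cast
    rw [h5]
    linarith
  have h7 : errBound c k l = epsBound c k l := min_eq_left hε.le
  rw [h7]
  have h8 : epsBound c k l ≤ epsBound c k l / (1 - epsBound c k l) := by
    have := epsBound_nonneg c k l
    rw [le_div_iff₀ (by linarith)]
    nlinarith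
  nlinarith

/-! ### Asymptotics -/

theorem errBound_div_le (c : ℝ) (k l : ℕ) :
    errBound c k l / (1 - errBound c k l) ≤ 2 * epsBound c k l := by
  have h1 := errBound_nonneg c k l
  have h2 := errBound_le_half c k l
  have h3 : errBound c k l ≤ epsBound c k l := min_le_left _ _
  rw [div_le_iff₀ (by linarith)]
  nlinarith

/-- Both exponents of `epsBound` are at least `√k` as soon as `128 c 2 ^ l log k ≤ √k`. -/
theorem epsBound_le {c : ℝ} {k l : ℕ} (h : Admissible c k l)
    (hk : 128 * c * 2 ^ l * Real.logb 2 k ≤ Real.sqrt k) :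
    epsBound c k l ≤ 9 * Real.exp (-Real.sqrt k) := by
  obtain ⟨hk0, hlam⟩ := h.one_le_mul_logb
  have hpow : (0 : ℝ) < 2 ^ l := by positivity
  have hsqrt : Real.sqrt k * Real.sqrt k = k := Real.mul_self_sqrt hk0.le
  have hs0 : 0 < Real.sqrt k := Real.sqrt_pos.2 hk0
  have key : ∀ b : ℝ, 0 < b → b ≤ Real.sqrt k → Real.exp (-(k / b)) ≤ Real.exp (-Real.sqrt k) := by
    intro b hb hbk
    refine Real.exp_le_exp.2 (neg_le_neg ?_)
    rw [le_div_iff₀ hb]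
    calc Real.sqrt k * b ≤ Real.sqrt k * Real.sqrt k := by gcongr
      _ = k := hsqrt
  have h1 : 128 * c * 2 ^ l * Real.logb 2 k = 128 * 2 ^ l * (c * Real.logb 2 k) := by ring
  have h2 : 128 * (2 : ℝ) ^ l * 1 ≤ 128 * 2 ^ l * (c * Real.logb 2 k) := by gcongr
  have h3 := key (128 * c * 2 ^ l * Real.logb 2 k) (by rw [h1]; linarith) hk
  have h4 := key (8 * 2 ^ l) (by positivity) (by linarith)
  rw [epsBound]
  linarith

theorem tendsto_logb_two_natCast :
    Tendsto (fun k : ℕ => Real.logb 2 (k : ℝ)) atTop atTop :=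
  (Real.tendsto_logb_atTop (by norm_num)).comp tendsto_natCast_atTop_atTop

theorem eventually_mul_two_pow_mul_logb_le {c : ℝ} (hc : 0 < c) {l : ℕ → ℕ}
    (hl : (fun k => (l k : ℝ)) =O[atTop] (fun k : ℕ => Real.logb 2 (Real.logb 2 k))) :
    ∀ᶠ k : ℕ in atTop, 128 * c * 2 ^ l k * Real.logb 2 k ≤ Real.sqrt k := by
  obtain ⟨B, hB⟩ := hl.bound
  -- `2 ^ l ≤ (log k) ^ B`, and powers of logarithms are of smaller order than `√k`
  have h1 : (fun k : ℕ => Real.log k ^ (B + 1)) =o[atTop] fun k : ℕ => (k : ℝ) ^ (1 / 2 : ℝ) :=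
    (isLittleO_log_rpow_rpow_atTop (B + 1) (by norm_num : (0 : ℝ) < 1 / 2)).comp_tendsto
      tendsto_natCast_atTop_atTop
  have hlog2 : 0 < Real.log 2 := Real.log_pos (by norm_num)
  have hδ : 0 < Real.log 2 ^ (B + 1) / (128 * c) := by positivity
  filter_upwards [hB, h1.bound hδ, tendsto_logb_two_natCast.eventually_ge_atTop 1] with k h2 h3 h4
  have hL0 : 0 < Real.logb 2 (k : ℝ) := by linarith
  have h5 : 0 ≤ Real.logb 2 (Real.logb 2 (k : ℝ)) := Real.logb_nonneg (by norm_num) h4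
  rw [Real.norm_of_nonneg (Nat.cast_nonneg _), Real.norm_of_nonneg h5] at h2
  have h6 : (2 : ℝ) ^ l k ≤ Real.logb 2 k ^ B := by
    calc (2 : ℝ) ^ l k = (2 : ℝ) ^ (l k : ℝ) := (Real.rpow_natCast _ _).symm
      _ ≤ (2 : ℝ) ^ (Real.logb 2 (Real.logb 2 (k : ℝ)) * B) :=
          Real.rpow_le_rpow_of_exponent_le (by norm_num) (by linarith)
      _ = _ := by rw [Real.rpow_mul (by norm_num), Real.rpow_logb (by norm_num) (by norm_num) hL0]
  have hlogk : 0 < Real.log k := by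
    have : Real.log k = Real.logb 2 k * Real.log 2 := by
      rw [Real.logb, div_mul_cancel₀ _ hlog2.ne']
    rw [this]
    positivity
  rw [Real.norm_of_nonneg (by positivity), Real.norm_of_nonneg (by positivity),
    ← Real.sqrt_eq_rpow] at h3
  calc 128 * c * 2 ^ l k * Real.logb 2 k
      ≤ 128 * c * Real.logb 2 k ^ B * Real.logb 2 k := by gcongr
    _ = 128 * c * Real.logb 2 k ^ (B + 1) := by rw [Real.rpow_add_one hL0.ne']; ring
    _ = 128 * c * (Real.log k ^ (B + 1) / Real.log 2 ^ (B + 1)) := by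
        rw [Real.logb, Real.div_rpow hlogk.le hlog2.le]
    _ ≤ 128 * c * (Real.log 2 ^ (B + 1) / (128 * c) * Real.sqrt k / Real.log 2 ^ (B + 1)) := by
        gcongr
    _ = Real.sqrt k := by field_simp

theorem superpolynomialDecay_errBound {c : ℝ} (hc : 0 < c) {l : ℕ → ℕ}
    (hadm : ∀ᶠ k in atTop, Admissible c k (l k))
    (hl : (fun k => (l k : ℝ)) =O[atTop] (fun k : ℕ => Real.logb 2 (Real.logb 2 k))) :
    SuperpolynomialDecay atTop (fun k : ℕ => (k : ℝ))
      (fun k => errBound c k (l k) / (1 - errBound c k (l k))) := by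
  intro n
  have h1 : Tendsto (fun k : ℕ => 18 * (Real.sqrt k ^ (2 * n) * Real.exp (-Real.sqrt k))) atTop
      (nhds (18 * 0)) :=
    ((Real.tendsto_pow_mul_exp_neg_atTop_nhds_zero (2 * n)).comp
      (Real.tendsto_sqrt_atTop.comp tendsto_natCast_atTop_atTop)).const_mul 18
  rw [mul_zero] at h1
  refine tendsto_of_tendsto_of_tendsto_of_le_of_le' tendsto_const_nhds h1 ?_ ?_
  · refine Eventually.of_forall fun k => ?_
    have h2 := errBound_nonneg c k (l k)
    have h3 := errBound_le_half c k (l k)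
    have h4 : 0 ≤ 1 - errBound c k (l k) := by linarith
    positivity
  · filter_upwards [hadm, eventually_mul_two_pow_mul_logb_le hc hl] with k h2 h3
    have h4 := (errBound_div_le c k (l k)).trans
      (mul_le_mul_of_nonneg_left (epsBound_le h2 h3) zero_le_two)
    rw [pow_mul, Real.sq_sqrt (Nat.cast_nonneg k)]
    calc _ ≤ (k : ℝ) ^ n * (2 * (9 * Real.exp (-Real.sqrt k))) := by gcongr
      _ = _ := by ring

theorem exists_admissible_isTheta {c : ℝ} (hc : 0 < c) :
    ∃ l : ℕ → ℕ, (∀ᶠ k in atTop, Admissible c k (l k)) ∧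
      (fun k => (l k : ℝ)) =Θ[atTop] (fun k : ℕ => Real.logb 2 (Real.logb 2 k)) := by
  obtain ⟨m, hm⟩ := pow_unbounded_of_one_lt (256 * c) (by norm_num : (1 : ℝ) < 2)
  have hLL : Tendsto (fun k : ℕ => Real.logb 2 (Real.logb 2 (k : ℝ))) atTop atTop :=
    (Real.tendsto_logb_atTop (by norm_num)).comp tendsto_logb_two_natCast
  refine ⟨fun k => ⌈Real.logb 2 (Real.logb 2 k)⌉₊ + (m + 14), ?_, ?_, ?_⟩
  · filter_upwards [tendsto_natCast_atTop_atTop.eventually_ge_atTop ((2 : ℝ) ^ (1 / c)),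
      tendsto_logb_two_natCast.eventually_ge_atTop 1, eventually_gt_atTop 0] with k h1 h2 h3
    refine ⟨hc, h1, ?_, by omega⟩
    have hk : (0 : ℝ) < k := by exact_mod_cast h3
    have hL0 : 0 < Real.logb 2 (k : ℝ) := by linarith
    rw [← Real.logb_le_iff_le_rpow (by norm_num) hk, le_div_iff₀ (by positivity)]
    have h4 : Real.logb 2 (k : ℝ) ≤ 2 ^ ⌈Real.logb 2 (Real.logb 2 (k : ℝ))⌉₊ := by
      rw [← Real.rpow_natCast, ← Real.logb_le_iff_le_rpow (by norm_num) hL0]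
      exact Nat.le_ceil _
    calc Real.logb 2 (k : ℝ) * (256 * c)
        ≤ 2 ^ ⌈Real.logb 2 (Real.logb 2 (k : ℝ))⌉₊ * 2 ^ (m + 14) := by
          gcongr
          refine hm.le.trans (pow_le_pow_right₀ (by norm_num) (by omega))
      _ = 2 ^ (⌈Real.logb 2 (Real.logb 2 (k : ℝ))⌉₊ + (m + 14)) := (pow_add _ _ _).symm
      _ = _ := by rw [← Real.rpow_natCast]
  · refine IsBigO.of_bound (m + 16) ?_
    filter_upwards [hLL.eventually_ge_atTop 1] with k h1
    rw [Real.norm_of_nonneg (Nat.cast_nonneg _), Real.norm_of_nonneg (by linarith)]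
    have h2 := Nat.ceil_lt_add_one (a := Real.logb 2 (Real.logb 2 (k : ℝ))) (by linarith)
    push_cast
    have h3 : (0 : ℝ) ≤ m := m.cast_nonneg
    nlinarith
  · refine IsBigO.of_bound 1 ?_
    filter_upwards [hLL.eventually_ge_atTop 1] with k h1
    rw [Real.norm_of_nonneg (Nat.cast_nonneg _), Real.norm_of_nonneg (by linarith)]
    have h2 := Nat.le_ceil (Real.logb 2 (Real.logb 2 (k : ℝ)))
    push_cast
    have h3 : (0 : ℝ) ≤ m := m.cast_nonneg
    linarith

end Fischlin

end

theorem mainTheorem2 :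
    ∃ ε : ℝ → ℕ → ℕ → ℝ,
      (∀ (c : ℝ) (k l : ℕ), Fischlin.Admissible c k l →
        0 ≤ ε c k l ∧ ε c k l < 1 ∧ ε c k l ≤ Fischlin.epsBound c k l) ∧
      (∀ (c : ℝ) (k l : ℕ), Fischlin.Admissible c k l →
        ∀ {X W M C Z St E : Type*}
          [Fintype M] [LinearOrder M] [Fintype C] [LinearOrder C] [Fintype Z] [LinearOrder Z]
          [Fintype E] [DecidableEq E]
          (R : X → W → Prop) (P : Fischlin.SigmaProtocol R M C Z St),
          P.UniqueResponses →
          (Fintype.card C : ℝ) = c * 2 ^ l * Real.logb 2 k →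
          ∀ (x : X) (a₀ : Fin k → M) (A : Fischlin.Prover k l M C Z E),
            Fischlin.winProb P x a₀ {a₀} A =
              ‖Matrix.toEuclideanLin (Fischlin.failProjComp P x a₀)
                (Matrix.toEuclideanLin (Fischlin.successProj P x a₀) A.finalState)‖ ^ 2 ∧
            ‖Matrix.toEuclideanLin (Fischlin.failProjComp P x a₀)
                (Matrix.toEuclideanLin (Fischlin.successProj P x a₀) A.finalState)‖ ^ 2 ≤
              ε c k l / (1 - ε c k l) ∧
            ∀ S : Set (Fin k → M), a₀ ∈ S →
              Fischlin.winProb P x a₀ S A ≤ ε c k l / (1 - ε c k l)) ∧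
      (∀ c : ℝ, 0 < c →
        (∀ l : ℕ → ℕ, (∀ᶠ k in atTop, Fischlin.Admissible c k (l k)) →
          (fun k => (l k : ℝ)) =O[atTop] (fun k : ℕ => Real.logb 2 (Real.logb 2 k)) →
          SuperpolynomialDecay atTop (fun k : ℕ => (k : ℝ))
            (fun k => ε c k (l k) / (1 - ε c k (l k)))) ∧
        ∃ l : ℕ → ℕ, (∀ᶠ k in atTop, Fischlin.Admissible c k (l k)) ∧
          (fun k => (l k : ℝ)) =Θ[atTop] (fun k : ℕ => Real.logb 2 (Real.logb 2 k))) := by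
  refine ⟨Fischlin.errBound, fun c k l _ => ⟨Fischlin.errBound_nonneg c k l, ?_, min_le_left _ _⟩,
    ?_, fun c hc => ⟨fun l => Fischlin.superpolynomialDecay_errBound hc,
      Fischlin.exists_admissible_isTheta hc⟩⟩
  · linarith [Fischlin.errBound_le_half c k l]
  · intro c k l h X W M C Z St E _ _ _ _ _ _ _ _ R P hP hC x a₀ A
    have hle := Fischlin.norm_sq_failProjComp_le h hP hC x a₀ A
    exact ⟨Fischlin.winProb_singleton hP x a₀ A, hle, fun S ha =>
      (Fischlin.winProb_le hP x a₀ ha A).trans hle⟩
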